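/- **Setting.** Let $r\ge 0$ and $\alpha\ge 2r+1$ be integers, $\Omega_1=\{(s,t):0\le t\le s\le 1\}$, $\Omega_2=\{(s,t):0\le s\le t\le 1\}$. Let $\kappa:[0,1]^2\to\mathbb R$ be a Green's kernel of class $C^\alpha$: $\kappa=\kappa_i$ on $\Omega_i$, with $\kappa_i\in C^{\alpha}(\Omega_i)$ (up to the boundary) for $i=1,2$, and $\kappa_1(s,s)=\kappa_2(s,s)$ for all $s\in[0,1]$. Let $(\mathcal K x)(s)=\int_0^1\kappa(s,t)x(t)\,dt$ be the integral operator on the complex space $L^2[0,1]$. For $n\ge1$ put $h=1/n$, let $\mathcal X_n$ be the space of functions on $[0,1]$ that are a polynomial of degree $\le 2r$ on each cell $(\frac{j-1}{n},\frac jn]$, $1\le j\le n$ (no continuity at the nodes), and let $P_n$ be the $L^2$-orthogonal projection onto $\mathcal X_n$. Write $\|\cdot\|_\infty$ for the (essential) supremum norm on $[0,1]$. Let $\lambda\ne 0$ be a simple eigenvalue of $\mathcal K$, let $\Gamma$ be a positively oriented circle centred at $\lambda$, contained in the resolvent set of $\mathcal K$, such that $\lambda$ is the only point of the spectrum of $\mathcal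 K$ on or inside $\Gamma$. Let $$E=-\frac1{2\pi i}\int_\Gamma(\mathcal K-zI)^{-1}\,dz,\qquad E_n=-\frac1{2\pi i}\int_\Gamma(P_n\mathcal K-zI)^{-1}\,dz .$$ (Simple means that the range $\mathcal R(E)$ has dimension one; this does not depend on the choice of $\Gamma$.) **Theorem.** There is a constant $C$ independent of $n$ such that for all sufficiently large $n$ the following holds. The circle $\Gamma$ lies in the resolvent set of $P_n\mathcal K$, $\dim\mathcal R(E_n)=1$, and the spectrum of $P_n\mathcal K$ inside $\Gamma$ consists of a single point $\lambda_n^G$, which is a nonzero eigenvalue (the Galerkin eigenvalue). There are $\varphi_n\in\mathcal R(E_n)$ with $\|\varphi_n\|_\infty=1$, and every such $\varphi_n$ is a Galerkin eigenvector, $P_n\mathcal K\varphi_n=\lambda_n^G\varphi_n$, and satisfies, with the iterated Galerkin eigenvector $\varphi_n^S=\frac1{\lambda_n^G}\mathcal K\varphi_n$, $$\|\varphi_n-E\varphi_n\|_\infty\le\begin{cases}C\,h^{2r+1}, & r\ge1,\\ C\,h, & r=0,\end{cases}\qquad \|\varphi_n^S-E\varphi_n^S\|_\infty\le\begin{cases}C\,h^{2r+3},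 & r\ge1,\\ C\,h^{2}, & r=0,\end{cases}$$ and $$|\lambda-\lambda_n^G|\le\begin{cases}C\,h^{2r+3}, & r\ge1,\\ C\,h^{2}, & r=0.\end{cases}$$ -/

import Mathlib

open MeasureTheory Filter Topology Polynomial

noncomputable section

namespace GreenGalerkin

/-- Lebesgue measure on `[0,1]`. -/
abbrev mu : Measure ℝ := volume.restrict (Set.Icc (0 : ℝ) 1)

/-- The complex Hilbert space `L²[0,1]`. -/
abbrev L2 : Type := Lp ℂ 2 mu

/-- The closed triangle `{(s,t) : 0 ≤ t ≤ s ≤ 1}`. -/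
def lowerTriangle : Set (ℝ × ℝ) := {p | 0 ≤ p.2 ∧ p.2 ≤ p.1 ∧ p.1 ≤ 1}

/-- The closed triangle `{(s,t) : 0 ≤ s ≤ t ≤ 1}`. -/
def upperTriangle : Set (ℝ × ℝ) := {p | 0 ≤ p.1 ∧ p.1 ≤ p.2 ∧ p.2 ≤ 1}

/-- A Green's kernel of class `C^α`: two real functions, each of class `C^α` on its closed
triangle (up to the boundary), which agree on the diagonal. -/
structure GreenKernel (α : ℕ) where
  /-- the branch on `0 ≤ t ≤ s ≤ 1` -/
  lower : ℝ × ℝ → ℝ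
  /-- the branch on `0 ≤ s ≤ t ≤ 1` -/
  upper : ℝ × ℝ → ℝ
  contDiffOn_lower : ContDiffOn ℝ α lower lowerTriangle
  contDiffOn_upper : ContDiffOn ℝ α upper upperTriangle
  diagonal : ∀ s ∈ Set.Icc (0 : ℝ) 1, lower (s, s) = upper (s, s)

namespace GreenKernel

variable {α : ℕ}

/-- The kernel `κ(s,t)`. -/
def ker (κ : GreenKernel α) (p : ℝ × ℝ) : ℝ :=
  if p.2 ≤ p.1 then κ.lower p else κ.upper p

lemma continuousOn_ker (κ : GreenKernel α) :
    ContinuousOn κ.ker (Set.Icc (0 : ℝ) 1 ×ˢ Set.Icc (0 : ℝ) 1) := by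
  have hclosedL : IsClosed lowerTriangle := by
    apply IsClosed.inter (isClosed_le continuous_const continuous_snd)
    exact (isClosed_le continuous_snd continuous_fst).inter
      (isClosed_le continuous_fst continuous_const)
  have hclosedU : IsClosed upperTriangle := by
    apply IsClosed.inter (isClosed_le continuous_const continuous_fst)
    exact (isClosed_le continuous_fst continuous_snd).inter
      (isClosed_le continuous_snd continuous_const)
  have hL : ContinuousOn κ.ker lowerTriangle :=
    κ.contDiffOn_lower.continuousOn.congr fun p hp => by
      simp [ker, hp.2.1]
  have hU : ContinuousOn κ.ker upperTriangle :=
    κ.contDiffOn_upper.continuousOn.congr fun p hp => by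
      obtain ⟨s, t⟩ := p
      obtain ⟨h0, h1, h2⟩ := hp
      dsimp only at h0 h1 h2
      by_cases h : t ≤ s
      · obtain rfl : s = t := le_antisymm h1 h
        simpa [ker] using κ.diagonal s ⟨h0, h2⟩
      · simp [ker, h]
  refine (hL.union_of_isClosed hU hclosedL hclosedU).mono ?_
  rintro ⟨s, t⟩ ⟨⟨hs0, hs1⟩, ht0, ht1⟩
  rcases le_total t s with h | h
  · exact Or.inl ⟨ht0, h, hs1⟩
  · exact Or.inr ⟨hs0, h, ht1⟩

lemma exists_bound (κ : GreenKernel α) :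
    ∃ M : ℝ, 0 ≤ M ∧ ∀ s ∈ Set.Icc (0 : ℝ) 1, ∀ t ∈ Set.Icc (0 : ℝ) 1, |κ.ker (s, t)| ≤ M := by
  obtain ⟨M, hM⟩ := (isCompact_Icc.prod isCompact_Icc).exists_bound_of_continuousOn
    κ.continuousOn_ker
  refine ⟨max M 0, le_max_right _ _, fun s hs t ht => ?_⟩
  exact (hM (s, t) ⟨hs, ht⟩).trans (le_max_left _ _)

/-- The function `s ↦ ∫₀¹ κ(s,t) x(t) dt`. -/
def integralFun (κ : GreenKernel α) (x : ℝ → ℂ) (s : ℝ) : ℂ :=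
  ∫ t, (κ.ker (s, t) : ℂ) * x t ∂mu

lemma aestronglyMeasurable_ker_section (κ : GreenKernel α) {s : ℝ}
    (hs : s ∈ Set.Icc (0 : ℝ) 1) :
    AEStronglyMeasurable (fun t => (κ.ker (s, t) : ℂ)) mu := by
  have h : ContinuousOn (fun t => (κ.ker (s, t) : ℂ)) (Set.Icc 0 1) :=
    Complex.continuous_ofReal.comp_continuousOn
      (κ.continuousOn_ker.comp (by fun_prop) fun t ht => ⟨hs, ht⟩)
  exact h.aestronglyMeasurable measurableSet_Icc

lemma integrable_section (κ : GreenKernel α) {s : ℝ} (hs : s ∈ Set.Icc (0 : ℝ) 1) (x : L2) :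
    Integrable (fun t => (κ.ker (s, t) : ℂ) * x t) mu := by
  obtain ⟨M, -, hM⟩ := κ.exists_bound
  have hx : Integrable (x : ℝ → ℂ) mu := (Lp.memLp x).integrable (by norm_num)
  refine hx.bdd_mul (c := M) (κ.aestronglyMeasurable_ker_section hs) ?_
  filter_upwards [ae_restrict_mem measurableSet_Icc] with t ht
  simpa using hM s hs t ht

lemma aestronglyMeasurable_integralFun (κ : GreenKernel α) (x : L2) :
    AEStronglyMeasurable (κ.integralFun x) mu := by
  have hk : AEStronglyMeasurable (fun p : ℝ × ℝ => (κ.ker p : ℂ)) (mu.prod mu) := by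
    rw [Measure.prod_restrict]
    exact (Complex.continuous_ofReal.comp_continuousOn
      κ.continuousOn_ker).aestronglyMeasurable (measurableSet_Icc.prod measurableSet_Icc)
  exact (hk.mul (Lp.aestronglyMeasurable x).comp_snd).integral_prod_right'

lemma norm_integralFun_le (κ : GreenKernel α) {M : ℝ} (hM0 : 0 ≤ M)
    (hM : ∀ s ∈ Set.Icc (0 : ℝ) 1, ∀ t ∈ Set.Icc (0 : ℝ) 1, |κ.ker (s, t)| ≤ M)
    (x : L2) {s : ℝ} (hs : s ∈ Set.Icc (0 : ℝ) 1) :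
    ‖κ.integralFun x s‖ ≤ M * ‖x‖ := by
  have hx : Integrable (x : ℝ → ℂ) mu := (Lp.memLp x).integrable (by norm_num)
  have h1 : ‖κ.integralFun x s‖ ≤ ∫ t, M * ‖x t‖ ∂mu := by
    refine norm_integral_le_of_norm_le (hx.norm.const_mul M) ?_
    filter_upwards [ae_restrict_mem measurableSet_Icc] with t ht
    rw [norm_mul]
    gcongr
    simpa using hM s hs t ht
  have hprob : IsProbabilityMeasure mu := ⟨by simp⟩
  have h2 : ∫ t, ‖x t‖ ∂mu ≤ ‖x‖ := by
    rw [integral_norm_eq_lintegral_enorm hx.1, ← eLpNorm_one_eq_lintegral_enorm, Lp.norm_def]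
    exact ENNReal.toReal_mono (Lp.eLpNorm_ne_top x)
      (eLpNorm_le_eLpNorm_of_exponent_le (by norm_num) hx.1)
  rw [integral_const_mul] at h1
  exact h1.trans (by gcongr)

lemma memLp_integralFun (κ : GreenKernel α) (x : L2) : MemLp (κ.integralFun x) 2 mu := by
  obtain ⟨M, hM0, hM⟩ := κ.exists_bound
  refine MemLp.of_bound (κ.aestronglyMeasurable_integralFun x) (M * ‖x‖) ?_
  filter_upwards [ae_restrict_mem measurableSet_Icc] with s hs
  exact κ.norm_integralFun_le hM0 hM x hs

/-- The integral operator `(K x)(s) = ∫₀¹ κ(s,t) x(t) dt` on `L²[0,1]`. -/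
def op (κ : GreenKernel α) : L2 →L[ℂ] L2 :=
  LinearMap.mkContinuousOfExistsBound
    { toFun := fun x => (κ.memLp_integralFun x).toLp (κ.integralFun x)
      map_add' := fun x y => by
        rw [← MemLp.toLp_add]
        refine MemLp.toLp_congr _ _ ?_
        filter_upwards [ae_restrict_mem measurableSet_Icc] with s hs
        rw [Pi.add_apply]
        unfold integralFun
        rw [← integral_add (κ.integrable_section hs x) (κ.integrable_section hs y)]
        refine integral_congr_ae ?_
        filter_upwards [Lp.coeFn_add x y] with t ht
        rw [ht, Pi.add_apply, mul_add]
      map_smul' := fun c x => by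
        rw [RingHom.id_apply, ← MemLp.toLp_const_smul]
        refine MemLp.toLp_congr _ _ (Eventually.of_forall fun s => ?_)
        rw [Pi.smul_apply]
        unfold integralFun
        rw [← integral_smul]
        refine integral_congr_ae ?_
        filter_upwards [Lp.coeFn_smul c x] with t ht
        rw [ht, Pi.smul_apply, smul_eq_mul, smul_eq_mul]
        ring }
    (by
      obtain ⟨M, hM0, hM⟩ := κ.exists_bound
      have hprob : IsProbabilityMeasure mu := ⟨by simp⟩
      refine ⟨M, fun x => ?_⟩
      have h := Lp.norm_le_of_ae_bound
        (f := (κ.memLp_integralFun x).toLp (κ.integralFun x)) (C := M * ‖x‖) (by positivity) (by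
          filter_upwards [(κ.memLp_integralFun x).coeFn_toLp,
            ae_restrict_mem measurableSet_Icc] with s h1 hs
          rw [h1]
          exact κ.norm_integralFun_le hM0 hM x hs)
      simpa [measureUnivNNReal] using h)

end GreenKernel

/-- The piecewise polynomial function equal to `p j` on `(j/n, (j+1)/n]`, `j = 0, …, n-1`. -/
def piecewisePoly (n : ℕ) (p : Fin n → ℂ[X]) (t : ℝ) : ℂ :=
  ∑ j : Fin n,
    (Set.Ioc ((j : ℝ) / n) (((j : ℝ) + 1) / n)).indicator (fun u : ℝ => (p j).eval (u : ℂ)) t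

lemma memLp_piecewisePoly (n : ℕ) (p : Fin n → ℂ[X]) : MemLp (piecewisePoly n p) 2 mu := by
  refine memLp_finsetSum _ fun j _ => MemLp.indicator measurableSet_Ioc ?_
  have hc : Continuous fun u : ℝ => (p j).eval (u : ℂ) := by fun_prop
  obtain ⟨M, hM⟩ := isCompact_Icc.exists_bound_of_continuousOn
    (s := Set.Icc (0 : ℝ) 1) hc.continuousOn
  refine MemLp.of_bound hc.aestronglyMeasurable M ?_
  filter_upwards [ae_restrict_mem measurableSet_Icc] with t ht
  exact hM t ht

lemma piecewisePoly_add (n : ℕ) (p q : Fin n → ℂ[X]) :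
    piecewisePoly n (p + q) = piecewisePoly n p + piecewisePoly n q := by
  funext t
  simp only [piecewisePoly, Pi.add_apply, eval_add, ← Finset.sum_add_distrib]
  refine Finset.sum_congr rfl fun j _ => ?_
  exact congrFun (Set.indicator_add _ (fun u : ℝ => (p j).eval (u : ℂ)) _) t

lemma piecewisePoly_smul (n : ℕ) (c : ℂ) (p : Fin n → ℂ[X]) :
    piecewisePoly n (c • p) = c • piecewisePoly n p := by
  funext t
  simp only [piecewisePoly, Pi.smul_apply, eval_smul, Finset.smul_sum]
  refine Finset.sum_congr rfl fun j _ => ?_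
  exact congrFun (Set.indicator_const_smul _ c (fun u : ℝ => (p j).eval (u : ℂ))) t

/-- The space `X_n` of (classes of) functions that are, on each cell of the uniform partition of
`[0,1]` into `n` cells, a polynomial of degree at most `2r`; no continuity at the nodes. -/
def approxSpace (r n : ℕ) : Submodule ℂ L2 where
  carrier := {f | ∃ p : Fin n → ℂ[X], (∀ j, (p j).natDegree ≤ 2 * r) ∧
    (f : ℝ → ℂ) =ᵐ[mu] piecewisePoly n p}
  zero_mem' := ⟨0, fun _ => by simp, by
    filter_upwards [Lp.coeFn_zero ℂ 2 mu] with t ht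
    rw [ht]
    simp [piecewisePoly]⟩
  add_mem' := by
    rintro f g ⟨p, hp, hf⟩ ⟨q, hq, hg⟩
    refine ⟨p + q, fun j => (natDegree_add_le _ _).trans (max_le (hp j) (hq j)), ?_⟩
    rw [piecewisePoly_add]
    exact (Lp.coeFn_add f g).trans (hf.add hg)
  smul_mem' := by
    rintro c f ⟨p, hp, hf⟩
    refine ⟨c • p, fun j => (natDegree_smul_le _ _).trans (hp j), ?_⟩
    rw [piecewisePoly_smul]
    exact (Lp.coeFn_smul c f).trans (hf.const_smul c)

instance finiteDimensional_approxSpace (r n : ℕ) : FiniteDimensional ℂ (approxSpace r n) := by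
  let g : (Fin n → degreeLT ℂ (2 * r + 1)) →ₗ[ℂ] L2 :=
    { toFun := fun p => (memLp_piecewisePoly n fun j => (p j : ℂ[X])).toLp _
      map_add' := fun p q => by
        rw [← MemLp.toLp_add]
        exact MemLp.toLp_congr _ _ (Eventually.of_forall fun t =>
          congrFun (piecewisePoly_add n (fun j => (p j : ℂ[X])) fun j => (q j : ℂ[X])) t)
      map_smul' := fun c p => by
        rw [RingHom.id_apply, ← MemLp.toLp_const_smul]
        exact MemLp.toLp_congr _ _ (Eventually.of_forall fun t =>
          congrFun (piecewisePoly_smul n c fun j => (p j : ℂ[X])) t) }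
  have hle : approxSpace r n ≤ LinearMap.range g := by
    rintro f ⟨p, hp, hf⟩
    refine ⟨fun j => ⟨p j, ?_⟩, ?_⟩
    · rw [mem_degreeLT]
      exact (degree_le_of_natDegree_le (hp j)).trans_lt (by exact_mod_cast Nat.lt_succ_self _)
    · refine Lp.ext ?_
      exact (MemLp.coeFn_toLp (memLp_piecewisePoly n p)).trans hf.symm
  have : FiniteDimensional ℂ (degreeLT ℂ (2 * r + 1)) :=
    Module.Finite.equiv (degreeLTEquiv ℂ (2 * r + 1)).symm
  exact Submodule.finiteDimensional_of_le hle

/-- The orthogonal projection `P_n` of `L²[0,1]` onto `X_n`. -/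
def proj (r n : ℕ) : L2 →L[ℂ] L2 := (approxSpace r n).starProjection

/-- The Galerkin operator `P_n K`. -/
def galerkinOp {α : ℕ} (κ : GreenKernel α) (r n : ℕ) : L2 →L[ℂ] L2 := proj r n ∘L κ.op

/-- The circle with centre `z₀` and radius `ε` lies in the resolvent set of `T` and separates `z₀`
from the rest of the spectrum. -/
def Separates (T : L2 →L[ℂ] L2) (z₀ : ℂ) (ε : ℝ) : Prop :=
  0 < ε ∧ ∀ z ∈ spectrum ℂ T, z ∈ Metric.closedBall z₀ ε → z = z₀

/-- The Riesz spectral projection `-(1/2πi) ∮ (T - z)⁻¹ dz` over the positively oriented circle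
with centre `z₀` and radius `ε`. -/
def spectralProj (T : L2 →L[ℂ] L2) (z₀ : ℂ) (ε : ℝ) : L2 →L[ℂ] L2 :=
  -((2 * (Real.pi : ℂ) * Complex.I)⁻¹ •
    ∮ z in C(z₀, ε), Ring.inverse (T - algebraMap ℂ (L2 →L[ℂ] L2) z))

/-- `z₀` is an eigenvalue of `T`. -/
def IsEigenvalue (T : L2 →L[ℂ] L2) (z₀ : ℂ) : Prop :=
  Module.End.HasEigenvalue (T : L2 →ₗ[ℂ] L2) z₀

/-- `z₀` is an isolated point of the spectrum and an eigenvalue of algebraic multiplicity one: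
the range of its spectral projection is one-dimensional. -/
def IsSimpleEigenvalue (T : L2 →L[ℂ] L2) (z₀ : ℂ) : Prop :=
  IsEigenvalue T z₀ ∧
    ∃ ε : ℝ, Separates T z₀ ε ∧ Module.finrank ℂ (spectralProj T z₀ ε).range = 1

/-- The norm `‖f‖_∞` on `[0,1]`, with value `∞` if `f` is not essentially bounded. -/
def essSupNorm (f : L2) : ENNReal := eLpNorm f ⊤ mu

/-- The order of the iterated eigenvector and of the eigenvalue: `2r+3` for `r ≥ 1`, `2` for
`r = 0`. -/
def superOrder (r : ℕ) : ℕ := if r = 0 then 2 else 2 * r + 3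

end GreenGalerkin

end

open GreenGalerkin

/-! Write `K`, `P` for the integral operator and the projection. `K` maps `L²` into Lipschitz
functions with constant proportional to the norm, so `P K → K` in operator norm
(`tendsto_galerkinOp`). Riesz projections depend continuously on the operator, and idempotents at
distance less than one have ranges of equal dimension. This gives the rank-one range of the
perturbed projection and a single eigenvalue `μ` inside the circle, forced close to `λ`.

The rates come from the residual `d = Kφ - μφ = (I - P)Kφ` of a Galerkin pair and the reduced
resolvent `S`, for which `S (λ - K) = 1 - E`. With `u = φ - Eφ` one has `d = λ (I - P)Eφ + (I -
P)Ku`. The first term has order `h^(2r+1)`, because eigenfunctions are of class `C^α` (a Green's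
kernel gains one derivative at each application); the second is at most `c h ‖u‖` and is absorbed.
Applying `S` gives `u = O(h^(2r+1))` in `L²`.

Superconvergence comes from `w = K d`. At a point `s`, `K(I - P)v` is the inner product of `κ(s,·) -
g` with `(I - P)v`, for any `g` in the approximation space. For `r ≥ 1` the section `κ(s,·)` is
approximated to order `h²` in `L¹`: linearly away from the kink at `t = s`, and by a constant, with
error `O(h)`, on the cell of length `h` containing the kink. For `r = 0` only one factor `h` is
gained. The other part, `K(I - P)Ku`, is `O(h² ‖u‖)`. Now `E w = λ (λ - μ) Eφ` bounds the eigenvalue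
error, and `y = Ku`, which is `μ` times the error of the iterated eigenvector, solves a residual
equation with source `w`.

These `L²` bounds become sup-norm bounds because `K` maps `L²` to `L^∞` and `P` is uniformly bounded
in the sup norm. `exists_galerkin_estimates` carries out this argument. -/

namespace GreenGalerkin

/-! ### Riesz projections in a Banach algebra and their continuity -/

section Riesz

open Metric

variable {A : Type*} [NormedRing A] [NormedAlgebra ℂ A]

theorem commute_resolvent {T a : A} (ha : Commute T a) (z : ℂ) : Commute (resolvent T z) a := by
  have h : Commute (algebraMap ℂ A z - T) a := (Algebra.commute_algebraMap_left z a).sub_left ha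
  by_cases hu : IsUnit (algebraMap ℂ A z - T)
  · obtain ⟨u, hu⟩ := hu
    rw [resolvent, ← hu, Ring.inverse_unit]
    exact Commute.units_inv_left (hu ▸ h)
  · rw [resolvent, Ring.inverse_non_unit _ hu]
    exact Commute.zero_left a

theorem sub_mul_resolvent {T : A} {z : ℂ} (hz : z ∈ resolventSet ℂ T) :
    (algebraMap ℂ A z - T) * resolvent T z = 1 :=
  Ring.mul_inverse_cancel _ hz

variable [CompleteSpace A]

theorem _root_.ContinuousLinearMap.circleIntegral_comp {E F : Type*} [NormedAddCommGroup E]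
    [NormedSpace ℂ E] [CompleteSpace E] [NormedAddCommGroup F] [NormedSpace ℂ F] [CompleteSpace F]
    (L : E →L[ℂ] F) {f : ℂ → E} {c : ℂ} {R : ℝ} (hf : CircleIntegrable f c R) :
    (∮ z in C(c, R), L (f z)) = L (∮ z in C(c, R), f z) := by
  simp only [circleIntegral]
  rw [← L.intervalIntegral_comp_comm hf.out]
  simp

/-- The Riesz projection `(1/2πi) ∮ (z - T)⁻¹ dz`. -/
noncomputable def rieszProj (T : A) (c : ℂ) (R : ℝ) : A :=
  (2 * (Real.pi : ℂ) * Complex.I)⁻¹ • ∮ z in C(c, R), resolvent T z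

/-- The Cauchy integral `(1/2πi) ∮ (z - w)⁻¹ (z - T)⁻¹ dz` of the resolvent. -/
noncomputable def cauchyResolvent (T : A) (c : ℂ) (R : ℝ) (w : ℂ) : A :=
  (2 * (Real.pi : ℂ) * Complex.I)⁻¹ • ∮ z in C(c, R), (z - w)⁻¹ • resolvent T z

theorem continuousOn_resolvent (T : A) : ContinuousOn (resolvent T) (resolventSet ℂ T) :=
  fun _ hz => (spectrum.hasDerivAt_resolvent_const_left hz).continuousAt.continuousWithinAt

theorem circleIntegrable_resolvent {T : A} {c : ℂ} {R : ℝ} (hR : 0 ≤ R)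
    (h : sphere c R ⊆ resolventSet ℂ T) : CircleIntegrable (resolvent T) c R :=
  ((continuousOn_resolvent T).mono h).circleIntegrable hR

theorem sub_ne_zero_of_mem_sphere_of_mem_ball {c z w : ℂ} {R : ℝ} (hz : z ∈ sphere c R)
    (hw : w ∈ ball c R) : z - w ≠ 0 := by
  rintro h
  obtain rfl := sub_eq_zero.mp h
  exact (ne_of_lt (mem_ball.mp hw)) (mem_sphere.mp hz)

theorem circleIntegrable_smul_resolvent {T : A} {c w : ℂ} {R : ℝ} (hR : 0 ≤ R)
    (h : sphere c R ⊆ resolventSet ℂ T) (hw : w ∈ ball c R) :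
    CircleIntegrable (fun z => (z - w)⁻¹ • resolvent T z) c R := by
  refine ContinuousOn.circleIntegrable hR (ContinuousOn.smul ?_ ((continuousOn_resolvent T).mono h))
  exact ContinuousOn.inv₀ (by fun_prop) fun z hz => sub_ne_zero_of_mem_sphere_of_mem_ball hz hw

theorem circleIntegral_mul_left (a : A) {f : ℂ → A} {c : ℂ} {R : ℝ} (hf : CircleIntegrable f c R) :
    (∮ z in C(c, R), a * f z) = a * ∮ z in C(c, R), f z :=
  (ContinuousLinearMap.mul ℂ A a).circleIntegral_comp hf

theorem circleIntegral_mul_right (a : A) {f : ℂ → A} {c : ℂ} {R : ℝ}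
    (hf : CircleIntegrable f c R) :
    (∮ z in C(c, R), f z * a) = (∮ z in C(c, R), f z) * a :=
  ((ContinuousLinearMap.mul ℂ A).flip a).circleIntegral_comp hf

theorem commute_rieszProj {T a : A} (ha : Commute T a) {c : ℂ} {R : ℝ} (hR : 0 ≤ R)
    (h : sphere c R ⊆ resolventSet ℂ T) : Commute (rieszProj T c R) a := by
  refine Commute.smul_left ?_ _
  have hi := circleIntegrable_resolvent hR h
  rw [Commute, SemiconjBy, ← circleIntegral_mul_left _ hi, ← circleIntegral_mul_right _ hi]
  exact circleIntegral.integral_congr hR fun z _ => (commute_resolvent ha z).eq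

theorem commute_cauchyResolvent {T a : A} (ha : Commute T a) {c w : ℂ} {R : ℝ} (hR : 0 ≤ R)
    (h : sphere c R ⊆ resolventSet ℂ T) (hw : w ∈ ball c R) :
    Commute (cauchyResolvent T c R w) a := by
  refine Commute.smul_left ?_ _
  have hi := circleIntegrable_smul_resolvent hR h hw
  rw [Commute, SemiconjBy, ← circleIntegral_mul_left _ hi, ← circleIntegral_mul_right _ hi]
  exact circleIntegral.integral_congr hR fun z _ => ((commute_resolvent ha z).smul_left _).eq

/-- `(w - T) S_w = 1 - E` inside the circle. -/
theorem sub_mul_cauchyResolvent {T : A} {c w : ℂ} {R : ℝ} (h : sphere c R ⊆ resolventSet ℂ T)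
    (hw : w ∈ ball c R) :
    (algebraMap ℂ A w - T) * cauchyResolvent T c R w = 1 - rieszProj T c R := by
  have hR : 0 ≤ R := (pos_of_mem_ball hw).le
  rw [cauchyResolvent, mul_smul_comm,
    ← circleIntegral_mul_left _ (circleIntegrable_smul_resolvent hR h hw)]
  have h1 : (∮ z in C(c, R), (algebraMap ℂ A w - T) * ((z - w)⁻¹ • resolvent T z)) =
      ∮ z in C(c, R), ((z - w)⁻¹ • (1 : A) - resolvent T z) := by
    refine circleIntegral.integral_congr hR fun z hz => ?_
    have hne := sub_ne_zero_of_mem_sphere_of_mem_ball hz hw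
    have h2 : algebraMap ℂ A w - T = (algebraMap ℂ A z - T) - (z - w) • (1 : A) := by
      simp only [Algebra.algebraMap_eq_smul_one, sub_smul]; abel
    simp only [h2, sub_mul, mul_smul_comm, smul_mul_assoc, one_mul]
    rw [← sub_mul, sub_mul_resolvent (h hz), smul_sub, smul_smul, inv_mul_cancel₀ hne, one_smul]
  have h3 : CircleIntegrable (fun z : ℂ => (z - w)⁻¹) c R := by
    refine ContinuousOn.circleIntegrable hR ?_
    exact ContinuousOn.inv₀ (by fun_prop) fun z hz => sub_ne_zero_of_mem_sphere_of_mem_ball hz hw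
  rw [h1, circleIntegral.integral_sub _ (circleIntegrable_resolvent hR h),
    circleIntegral.integral_smul_const, circleIntegral.integral_sub_inv_of_mem_ball hw, smul_sub,
    smul_smul, inv_mul_cancel₀ Complex.two_pi_I_ne_zero, one_smul, rieszProj]
  exact ContinuousOn.circleIntegrable hR ((ContinuousOn.inv₀ (by fun_prop) fun z hz =>
    sub_ne_zero_of_mem_sphere_of_mem_ball hz hw).smul continuousOn_const)

/-- Cauchy's theorem on the annulus, where the resolvent is holomorphic. -/
theorem rieszProj_eq_of_annulus {T : A} {c : ℂ} {r R : ℝ} (hr : 0 < r) (hrR : r ≤ R)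
    (h : closedBall c R \ ball c r ⊆ resolventSet ℂ T) : rieszProj T c R = rieszProj T c r := by
  rw [rieszProj, rieszProj]
  congr 1
  refine Complex.circleIntegral_eq_of_differentiable_on_annulus_off_countable hr hrR
    Set.countable_empty ((continuousOn_resolvent T).mono h) ?_
  rintro z ⟨⟨hz1, hz2⟩, -⟩
  refine (spectrum.hasDerivAt_resolvent_const_left (h ⟨ball_subset_closedBall hz1, ?_⟩)).differentiableAt
  exact fun hz => hz2 (ball_subset_closedBall hz)

/-- A Cauchy integral over the outer circle is a power series in `w`, hence holomorphic in the whole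
open disc, whatever spectrum of `T` lies inside. -/
theorem circleIntegral_cauchyResolvent_eq_zero {T : A} {c : ℂ} {r R : ℝ} (hr : 0 ≤ r) (hrR : r < R)
    (h : sphere c R ⊆ resolventSet ℂ T) : (∮ w in C(c, r), cauchyResolvent T c R w) = 0 := by
  have hR : 0 < R := hr.trans_lt hrR
  lift R to NNReal using hR.le
  have hF := hasFPowerSeriesOn_cauchy_integral (circleIntegrable_resolvent hR.le h)
    (by exact_mod_cast hR)
  have hd : DifferentiableOn ℂ (cauchyResolvent T c R) (ball c R) := by
    have := hF.differentiableOn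
    rwa [Metric.eball_coe] at this
  exact Complex.circleIntegral_eq_zero_of_differentiable_on_off_countable hr Set.countable_empty
    (hd.continuousOn.mono (closedBall_subset_ball hrR)) fun z hz =>
      hd.differentiableAt (isOpen_ball.mem_nhds (ball_subset_ball hrR.le hz.1))

/-- Two concentric circles are used. Multiplying `(w - T) S_w = 1 - E` by the resolvent and
integrating over the inner circle removes the `S_w` term, so the product of the two projections is
the inner one; both are equal by deformation of the contour. -/
theorem isIdempotentElem_rieszProj {T : A} {c : ℂ} {r R : ℝ} (hr : 0 < r) (hrR : r < R)
    (h : closedBall c R \ ball c r ⊆ resolventSet ℂ T) : IsIdempotentElem (rieszProj T c R) := by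
  have hR : 0 < R := hr.trans hrR
  have hsR : sphere c R ⊆ resolventSet ℂ T := fun z hz => h ⟨sphere_subset_closedBall hz, by
    simp only [mem_ball, not_lt]; rw [mem_sphere.mp hz]; exact hrR.le⟩
  have hsr : sphere c r ⊆ resolventSet ℂ T := fun z hz => h ⟨by
    rw [mem_closedBall, mem_sphere.mp hz]; exact hrR.le, by
    simp only [mem_ball, not_lt]; rw [mem_sphere.mp hz]⟩
  have hint := circleIntegrable_resolvent hr.le hsr
  have hcr : ∀ w ∈ sphere c r, resolvent T w * rieszProj T c R =
      resolvent T w - cauchyResolvent T c R w := fun w hw => by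
    have hwR : w ∈ ball c R := by rw [mem_ball, mem_sphere.mp hw]; exact hrR
    have h1 := congrArg (resolvent T w * ·) (sub_mul_cauchyResolvent hsR hwR)
    have h2 : resolvent T w * (algebraMap ℂ A w - T) = 1 := Ring.inverse_mul_cancel _ (hsr hw)
    simp only [← mul_assoc, h2, one_mul, mul_sub, mul_one] at h1
    rw [h1, sub_sub_cancel]
  have hprod : rieszProj T c r * rieszProj T c R = rieszProj T c r := by
    rw [rieszProj, smul_mul_assoc, ← circleIntegral_mul_right _ hint,
      circleIntegral.integral_congr hr.le hcr, circleIntegral.integral_sub hint,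
      circleIntegral_cauchyResolvent_eq_zero hr.le hrR hsR, sub_zero]
    have hci : CircleIntegrable (fun w => resolvent T w - resolvent T w * rieszProj T c R) c r := by
      refine ContinuousOn.circleIntegrable hr.le ?_
      have := (continuousOn_resolvent T).mono hsr
      fun_prop
    refine (circleIntegrable_congr fun w hw => ?_).mp hci
    rw [abs_of_nonneg hr.le] at hw
    simp only [hcr w hw, sub_sub_cancel]
  rw [IsIdempotentElem]
  nth_rewrite 1 [rieszProj_eq_of_annulus hr hrR.le h]
  rw [hprod, rieszProj_eq_of_annulus hr hrR.le h]

theorem eventually_subset_resolventSet {T : A} {Z : Set ℂ} (hZ : IsCompact Z)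
    (h : Z ⊆ resolventSet ℂ T) : ∀ᶠ T' in 𝓝 T, Z ⊆ resolventSet ℂ T' := by
  refine hZ.eventually_forall_of_forall_eventually fun z hz => ?_
  have hc : ContinuousAt (fun p : A × ℂ => algebraMap ℂ A p.2 - p.1) (T, z) := by fun_prop
  exact hc.eventually (Units.isOpen.mem_nhds (h hz))

theorem tendsto_rieszProj {T : A} {c : ℂ} {R : ℝ} (hR : 0 ≤ R) (h : sphere c R ⊆ resolventSet ℂ T) :
    Tendsto (fun T' => rieszProj T' c R) (𝓝 T) (𝓝 (rieszProj T c R)) := by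
  rw [Metric.tendsto_nhds]
  intro δ hδ
  -- The integral costs a factor `R`; dividing by `R + 1` keeps the final inequality strict and
  -- covers `R = 0`.
  have hη : 0 < δ / (R + 1) := by positivity
  have hunif : ∀ᶠ T' in 𝓝 T, ∀ z ∈ sphere c R,
      ‖resolvent T' z - resolvent T z‖ < δ / (R + 1) := by
    refine (isCompact_sphere c R).eventually_forall_of_forall_eventually fun z hz => ?_
    have hu : ContinuousAt (Ring.inverse : A → A) (algebraMap ℂ A z - T) := by
      obtain ⟨u, hu⟩ := h hz
      rw [← hu]; exact NormedRing.inverse_continuousAt u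
    have hc : ContinuousAt (fun p : A × ℂ => resolvent p.1 p.2) (T, z) :=
      ContinuousAt.comp (f := fun p : A × ℂ => algebraMap ℂ A p.2 - p.1) (g := Ring.inverse)
        (x := (T, z)) hu (by fun_prop)
    have hc' : ContinuousAt (fun p : A × ℂ => resolvent T p.2) (T, z) :=
      ContinuousAt.comp (f := Prod.snd) (g := resolvent T) (x := (T, z))
        (spectrum.hasDerivAt_resolvent_const_left (h hz)).continuousAt (by fun_prop)
    have := (hc.sub hc').norm
    refine this.eventually_lt continuousAt_const ?_
    simpa using hη
  filter_upwards [hunif, eventually_subset_resolventSet (isCompact_sphere c R) h] with T' h1 h2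
  rw [dist_eq_norm, rieszProj, rieszProj, ← smul_sub,
    ← circleIntegral.integral_sub (circleIntegrable_resolvent hR h2)
      (circleIntegrable_resolvent hR h)]
  refine (circleIntegral.norm_two_pi_i_inv_smul_integral_le_of_norm_le_const hR
    fun z hz => (h1 z hz).le).trans_lt ?_
  rw [mul_div_assoc', div_lt_iff₀ (by positivity)]
  nlinarith

end Riesz

end GreenGalerkin

namespace GreenGalerkin

/-! ### Rank-one spectral projections of bounded operators -/

section SpectralProjection

open Metric

variable {X : Type*} [NormedAddCommGroup X] [NormedSpace ℂ X]

theorem resolvent_apply_eigenvector {T : X →L[ℂ] X} {μ z : ℂ} {v : X}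
    (hz : z ∈ resolventSet ℂ T) (hzμ : z ≠ μ) (hv : T v = μ • v) :
    resolvent T z v = (z - μ)⁻¹ • v := by
  have h2 : resolvent T z * (algebraMap ℂ _ z - T) = 1 := Ring.inverse_mul_cancel _ hz
  have h3 := DFunLike.congr_fun h2 v
  simp only [mul_apply_eq_comp, sub_apply,
    Algebra.algebraMap_eq_smul_one, smul_apply,
    one_apply_eq_self, hv, ← sub_smul, map_smul] at h3
  rw [eq_inv_smul_iff₀ (sub_ne_zero.mpr hzμ), h3]

theorem mem_spectrum_of_eigenvector {T : X →L[ℂ] X} {μ : ℂ} {v : X} (hv0 : v ≠ 0)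
    (hv : T v = μ • v) : μ ∈ spectrum ℂ T := by
  intro h
  have h2 : resolvent T μ * (algebraMap ℂ _ μ - T) = 1 := Ring.inverse_mul_cancel _ h
  have h3 := DFunLike.congr_fun h2 v
  simp only [mul_apply_eq_comp, sub_apply,
    Algebra.algebraMap_eq_smul_one, smul_apply,
    one_apply_eq_self, hv, sub_self, map_zero] at h3
  exact hv0 h3.symm

theorem apply_mem_range_of_isIdempotentElem {E : X →L[ℂ] X} (hE : IsIdempotentElem E) {x : X}
    (hx : x ∈ E.range) : E x = x := by
  obtain ⟨y, rfl⟩ := hx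
  exact DFunLike.congr_fun hE y

/-- If `P x = x` and `Q x = 0`, then `‖x‖ ≤ ‖P - Q‖ ‖x‖` forces `x = 0`, so `Q` is injective on the
range of `P`. -/
theorem finite_range_and_finrank_le_of_norm_sub_lt_one {P Q : X →L[ℂ] X} (hP : IsIdempotentElem P)
    [Module.Finite ℂ Q.range] (h : ‖P - Q‖ < 1) :
    Module.Finite ℂ P.range ∧ Module.finrank ℂ P.range ≤ Module.finrank ℂ Q.range := by
  let f : P.range →ₗ[ℂ] Q.range := ((Q : X →ₗ[ℂ] X).rangeRestrict).comp P.range.subtype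
  have hf : Function.Injective f := by
    rw [← LinearMap.ker_eq_bot, LinearMap.ker_eq_bot']
    rintro ⟨x, hx⟩ hfx
    have hQ : Q x = 0 := congrArg Subtype.val hfx
    have hPx := apply_mem_range_of_isIdempotentElem hP hx
    have h1 : ‖x‖ ≤ ‖P - Q‖ * ‖x‖ := by
      simpa [hPx, hQ] using (P - Q).le_opNorm x
    have h2 : ‖x‖ = 0 := by
      by_contra h0
      have : 0 < ‖x‖ := lt_of_le_of_ne (norm_nonneg _) (Ne.symm h0)
      nlinarith
    simpa using h2
  exact ⟨Module.Finite.of_injective f hf, LinearMap.finrank_le_finrank_of_injective hf⟩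

theorem finrank_range_eq_of_norm_sub_lt_one {P Q : X →L[ℂ] X} (hP : IsIdempotentElem P)
    (hQ : IsIdempotentElem Q) [Module.Finite ℂ Q.range] (h : ‖P - Q‖ < 1) :
    Module.finrank ℂ P.range = Module.finrank ℂ Q.range := by
  obtain ⟨hfin, hle⟩ := finite_range_and_finrank_le_of_norm_sub_lt_one hP h
  exact hle.antisymm
    (finite_range_and_finrank_le_of_norm_sub_lt_one hQ (by rwa [norm_sub_rev])).2

theorem exists_fixed_of_finrank_range_eq_one {E : X →L[ℂ] X} (hE : IsIdempotentElem E)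
    (h : Module.finrank ℂ E.range = 1) : ∃ w : X, w ≠ 0 ∧ w ∈ E.range ∧ E w = w := by
  obtain ⟨⟨w, hw⟩, hw0, -⟩ := finrank_eq_one_iff'.mp h
  exact ⟨w, by simpa using hw0, hw, apply_mem_range_of_isIdempotentElem hE hw⟩

variable [CompleteSpace X]

/-- On `v` the resolvent acts as the scalar `(z - μ)⁻¹`, which is holomorphic on the disc when `μ`
lies outside it. -/
theorem rieszProj_apply_eigenvector_of_notMem {T : X →L[ℂ] X} {c μ : ℂ} {R : ℝ} {v : X}
    (hR : 0 ≤ R) (h : sphere c R ⊆ resolventSet ℂ T) (hμ : μ ∉ closedBall c R)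
    (hv : T v = μ • v) : rieszProj T c R v = 0 := by
  have h1 := ((ContinuousLinearMap.apply ℂ X v).circleIntegral_comp
    (circleIntegrable_resolvent hR h))
  simp only [ContinuousLinearMap.apply_apply] at h1
  rw [rieszProj, smul_apply, ← h1,
    circleIntegral.integral_congr hR (g := fun z => (z - μ)⁻¹ • v) fun z hz => ?_,
    circleIntegral.integral_smul_const,
    Complex.circleIntegral_eq_zero_of_differentiable_on_off_countable hR Set.countable_empty,
    zero_smul, smul_zero]
  · exact ContinuousOn.inv₀ (by fun_prop) fun z hz h0 => hμ (sub_eq_zero.mp h0 ▸ hz)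
  · intro z hz
    refine DifferentiableAt.inv (by fun_prop) fun h0 => hμ ?_
    exact sub_eq_zero.mp h0 ▸ ball_subset_closedBall hz.1
  · refine resolvent_apply_eigenvector (h hz) ?_ hv
    rintro rfl
    exact hμ (sphere_subset_closedBall hz)

/-- A rank-one invariant subspace of a Riesz projection consists of eigenvectors, with an
eigenvalue inside the circle. -/
theorem exists_eigenvalue_of_finrank_range_rieszProj {T : X →L[ℂ] X} {c : ℂ} {R : ℝ} (hR : 0 ≤ R)
    (h : sphere c R ⊆ resolventSet ℂ T)
    (hE : ∃ w : X, w ≠ 0 ∧ w ∈ (rieszProj T c R).range ∧ rieszProj T c R w = w)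
    (hrank : Module.finrank ℂ (rieszProj T c R).range = 1) :
    ∃ μ ∈ ball c R, ∀ x ∈ (rieszProj T c R).range, T x = μ • x := by
  obtain ⟨w, hw0, hw, hEw⟩ := hE
  have hspan : ∀ x ∈ (rieszProj T c R).range, ∃ a : ℂ, a • w = x := fun x hx => by
    obtain ⟨a, ha⟩ := (finrank_eq_one_iff_of_nonzero' (⟨w, hw⟩ : (rieszProj T c R).range)
      (by simpa using hw0)).mp hrank ⟨x, hx⟩
    exact ⟨a, congrArg Subtype.val ha⟩
  have hcomm := commute_rieszProj (Commute.refl T) hR h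
  obtain ⟨μ, hμ⟩ := hspan (T w) ⟨T w, by
    rw [ContinuousLinearMap.coe_coe]
    have := DFunLike.congr_fun hcomm.eq w
    simpa [hEw] using this⟩
  refine ⟨μ, ?_, fun x hx => ?_⟩
  -- On the circle `μ` would contradict the resolvent hypothesis; outside the closed disc the
  -- projection would kill `w`, although it fixes `w`.
  · by_contra hball
    by_cases hcl : μ ∈ closedBall c R
    · refine mem_spectrum_of_eigenvector hw0 hμ.symm (h ?_)
      rw [mem_sphere]
      exact le_antisymm (mem_closedBall.mp hcl) (not_lt.mp hball)
    · exact hw0 (hEw ▸ rieszProj_apply_eigenvector_of_notMem hR h hcl hμ.symm)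
  · obtain ⟨a, rfl⟩ := hspan x hx
    rw [map_smul, ← hμ, smul_comm]

/-- For `w ≠ μ` in the disc the inverse of `w - T` is explicit: `S_w` on the range of `1 - E` and
the scalar `(w - μ)⁻¹` on the range of `E`. -/
theorem spectrum_inter_ball_eq_singleton {T : X →L[ℂ] X} {c μ : ℂ} {R : ℝ}
    (h : sphere c R ⊆ resolventSet ℂ T) (hE : IsIdempotentElem (rieszProj T c R))
    (hμ : μ ∈ ball c R) (hT : ∀ x ∈ (rieszProj T c R).range, T x = μ • x)
    (hne : ∃ x ∈ (rieszProj T c R).range, x ≠ 0) : spectrum ℂ T ∩ ball c R = {μ} := by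
  have hR : 0 ≤ R := (pos_of_mem_ball hμ).le
  refine Set.Subset.antisymm ?_ ?_
  · rintro w ⟨hw, hwb⟩
    by_contra hwμ
    have hwμ' : w - μ ≠ 0 := sub_ne_zero.mpr hwμ
    refine hw ?_
    set E := rieszProj T c R with hEdef
    set S := cauchyResolvent T c R w with hS
    have hTE : T * E = μ • E := by
      ext x
      exact hT (E x) ⟨x, rfl⟩
    have hcE : Commute E T := commute_rieszProj (Commute.refl T) hR h
    have hcS : Commute S T := commute_cauchyResolvent (Commute.refl T) hR h hwb
    have hSE : Commute S E := commute_cauchyResolvent hcE.symm hR h hwb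
    have hwS : (algebraMap ℂ _ w - T) * S = 1 - E := sub_mul_cauchyResolvent h hwb
    have hwE : (algebraMap ℂ _ w - T) * E = (w - μ) • E := by
      rw [sub_mul, hTE, Algebra.algebraMap_eq_smul_one, smul_mul_assoc, one_mul, sub_smul]
    have hright : (algebraMap ℂ _ w - T) * (S * (1 - E) + (w - μ)⁻¹ • E) = 1 := by
      rw [mul_add, ← mul_assoc, hwS, mul_smul_comm, hwE, smul_smul, inv_mul_cancel₀ hwμ',
        one_smul, hE.one_sub.eq, sub_add_cancel]
    have hcomm : Commute (algebraMap ℂ (X →L[ℂ] X) w - T) (S * (1 - E) + (w - μ)⁻¹ • E) := by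
      refine Commute.sub_left (Algebra.commute_algebraMap_left _ _) ?_
      exact (hcS.symm.mul_right ((Commute.one_right T).sub_right hcE.symm)).add_right
        (hcE.symm.smul_right _)
    exact ⟨⟨_, _, hright, hcomm.eq ▸ hright⟩, rfl⟩
  · rintro w rfl
    obtain ⟨x, hx, hx0⟩ := hne
    exact ⟨mem_spectrum_of_eigenvector hx0 (hT x hx), hμ⟩

end SpectralProjection

/-! ### Spectral projections on `L²[0,1]` and simple eigenvalues -/

open Metric

/-- The minus sign in front of the integral cancels the one from `(T - z)⁻¹ = -(z - T)⁻¹`. -/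
theorem spectralProj_eq_rieszProj (T : L2 →L[ℂ] L2) (c : ℂ) (R : ℝ) :
    spectralProj T c R = rieszProj T c R := by
  have h : ∀ z : ℂ, Ring.inverse (T - algebraMap ℂ (L2 →L[ℂ] L2) z) = -resolvent T z := fun z => by
    rw [resolvent, ← neg_sub (algebraMap ℂ (L2 →L[ℂ] L2) z) T]
    by_cases hu : IsUnit (algebraMap ℂ (L2 →L[ℂ] L2) z - T)
    · obtain ⟨u, hu⟩ := hu
      rw [← hu, Ring.inverse_unit, ← Units.val_neg, Ring.inverse_unit, inv_neg, Units.val_neg]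
    · rw [Ring.inverse_non_unit _ hu, Ring.inverse_non_unit _ (by rwa [IsUnit.neg_iff]), neg_zero]
  simp only [spectralProj, h, rieszProj, circleIntegral, smul_neg,
    intervalIntegral.integral_neg, neg_neg]

theorem Separates.annulus_subset {T : L2 →L[ℂ] L2} {c : ℂ} {r R : ℝ} (h : Separates T c R)
    (hr : 0 < r) : closedBall c R \ ball c r ⊆ resolventSet ℂ T := by
  rintro z ⟨hz1, hz2⟩
  by_contra hz
  obtain rfl := h.2 z hz hz1
  exact hz2 (mem_ball_self hr)

theorem sphere_subset_annulus {c : ℂ} {r R : ℝ} (h : r ≤ R) :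
    sphere c R ⊆ closedBall c R \ ball c r := fun z hz =>
  ⟨sphere_subset_closedBall hz, by rw [mem_ball, mem_sphere.mp hz]; exact not_lt.mpr h⟩

theorem Separates.spectralProj_eq {T : L2 →L[ℂ] L2} {c : ℂ} {r R : ℝ} (h : Separates T c R)
    (h' : Separates T c r) : spectralProj T c R = spectralProj T c r := by
  rw [spectralProj_eq_rieszProj, spectralProj_eq_rieszProj]
  rcases le_total r R with hle | hle
  · exact rieszProj_eq_of_annulus h'.1 hle (h.annulus_subset h'.1)
  · exact (rieszProj_eq_of_annulus h.1 hle (h'.annulus_subset h.1)).symm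

/-- The spectral projection of a simple eigenvalue is an idempotent of rank one onto the
eigenspace. -/
theorem IsSimpleEigenvalue.rieszProj_spec {T : L2 →L[ℂ] L2} {c : ℂ} {R : ℝ}
    (hT : IsSimpleEigenvalue T c) (h : Separates T c R) :
    IsIdempotentElem (rieszProj T c R) ∧ Module.finrank ℂ (rieszProj T c R).range = 1 ∧
      ∀ x, T (rieszProj T c R x) = c • rieszProj T c R x := by
  obtain ⟨heig, r, hr, hrank⟩ := hT
  rw [hr.spectralProj_eq h, spectralProj_eq_rieszProj] at hrank
  have hE : IsIdempotentElem (rieszProj T c R) :=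
    isIdempotentElem_rieszProj (half_pos h.1) (half_lt_self h.1) (h.annulus_subset (half_pos h.1))
  have hs : sphere c R ⊆ resolventSet ℂ T :=
    (sphere_subset_annulus le_rfl).trans (h.annulus_subset h.1)
  obtain ⟨μ, hμ, hTμ⟩ := exists_eigenvalue_of_finrank_range_rieszProj h.1.le hs
    (exists_fixed_of_finrank_range_eq_one hE hrank) hrank
  obtain ⟨w, hw0, hw, -⟩ := exists_fixed_of_finrank_range_eq_one hE hrank
  obtain rfl : μ = c :=
    h.2 μ (mem_spectrum_of_eigenvector hw0 (hTμ w hw)) (ball_subset_closedBall hμ)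
  exact ⟨hE, hrank, fun x => hTμ _ ⟨x, rfl⟩⟩

end GreenGalerkin

namespace GreenGalerkin

/-! ### Essential bounds and sections of the kernel -/

open scoped ComplexConjugate

/-- `B` is an almost everywhere bound for `x`. -/
def EssBdd (x : L2) (B : ℝ) : Prop := ∀ᵐ t ∂mu, ‖x t‖ ≤ B

instance isProbabilityMeasure_mu : IsProbabilityMeasure mu := ⟨by simp⟩

theorem EssBdd.mono {x : L2} {B B' : ℝ} (h : EssBdd x B) (hB : B ≤ B') : EssBdd x B' :=
  Eventually.mono h fun _ ht => ht.trans hB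

theorem EssBdd.add {x y : L2} {B B' : ℝ} (h : EssBdd x B) (h' : EssBdd y B') :
    EssBdd (x + y) (B + B') := by
  filter_upwards [h, h', Lp.coeFn_add x y] with t h1 h2 h3
  rw [h3]
  exact (norm_add_le _ _).trans (add_le_add h1 h2)

theorem EssBdd.sub {x y : L2} {B B' : ℝ} (h : EssBdd x B) (h' : EssBdd y B') :
    EssBdd (x - y) (B + B') := by
  filter_upwards [h, h', Lp.coeFn_sub x y] with t h1 h2 h3
  rw [h3]
  exact (norm_sub_le _ _).trans (add_le_add h1 h2)

theorem EssBdd.smul {x : L2} {B : ℝ} (c : ℂ) (h : EssBdd x B) : EssBdd (c • x) (‖c‖ * B) := by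
  filter_upwards [h, Lp.coeFn_smul c x] with t h1 h3
  rw [h3, Pi.smul_apply, norm_smul]
  gcongr

theorem EssBdd.norm_le {x : L2} {B : ℝ} (hB : 0 ≤ B) (h : EssBdd x B) : ‖x‖ ≤ B := by
  simpa [measureUnivNNReal] using Lp.norm_le_of_ae_bound hB h

theorem EssBdd.essSupNorm_le {x : L2} {B : ℝ} (h : EssBdd x B) :
    essSupNorm x ≤ ENNReal.ofReal B := by
  rw [essSupNorm, eLpNorm_exponent_top]
  exact eLpNormEssSup_le_of_ae_bound h

theorem essBdd_of_essSupNorm_eq_one {x : L2} (h : essSupNorm x = 1) : EssBdd x 1 := by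
  rw [essSupNorm, eLpNorm_exponent_top] at h
  filter_upwards [ae_le_eLpNormEssSup (f := (x : ℝ → ℂ)) (μ := mu)] with t ht
  rw [h, ← ofReal_norm, ← ENNReal.ofReal_one] at ht
  exact (ENNReal.ofReal_le_ofReal_iff zero_le_one).mp ht

theorem norm_sq_eq_integral (x : L2) : ‖x‖ ^ 2 = ∫ t, ‖x t‖ ^ 2 ∂mu := by
  have h : (inner ℂ x x : ℂ) = ((∫ t, ‖x t‖ ^ 2 ∂mu : ℝ) : ℂ) := by
    rw [L2.inner_def, ← integral_complex_ofReal]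
    refine integral_congr_ae (Eventually.of_forall fun t => ?_)
    simp [inner_self_eq_norm_sq_to_K]
  rw [inner_self_eq_norm_sq_to_K, RCLike.ofReal_eq_complex_ofReal, ← Complex.ofReal_pow] at h
  exact Complex.ofReal_injective h

theorem norm_inner_le_integral (x y : L2) : ‖(inner ℂ x y : ℂ)‖ ≤ ∫ t, ‖x t‖ * ‖y t‖ ∂mu := by
  rw [L2.inner_def]
  refine norm_integral_le_of_norm_le ?_ (Eventually.of_forall fun t => norm_inner_le_norm _ _)
  exact (Lp.memLp x).norm.integrable_mul (Lp.memLp y).norm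

namespace GreenKernel

variable {α : ℕ} (κ : GreenKernel α)

theorem coeFn_op (x : L2) : (κ.op x : ℝ → ℂ) =ᵐ[mu] κ.integralFun x :=
  (κ.memLp_integralFun x).coeFn_toLp

theorem exists_essBdd_op : ∃ M : ℝ, 0 ≤ M ∧ ∀ x : L2, EssBdd (κ.op x) (M * ‖x‖) := by
  obtain ⟨M, hM0, hM⟩ := κ.exists_bound
  refine ⟨M, hM0, fun x => ?_⟩
  filter_upwards [κ.coeFn_op x, ae_restrict_mem measurableSet_Icc] with s h1 hs
  rw [h1]
  exact κ.norm_integralFun_le hM0 hM x hs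

/-- The section `t ↦ κ(s,t)` as an element of `L²`. -/
noncomputable def kerSection {s : ℝ} (hs : s ∈ Set.Icc (0 : ℝ) 1) : L2 :=
  MemLp.toLp (fun t => (κ.ker (s, t) : ℂ)) (by
    obtain ⟨M, -, hM⟩ := κ.exists_bound
    refine MemLp.of_bound (κ.aestronglyMeasurable_ker_section hs) M ?_
    filter_upwards [ae_restrict_mem measurableSet_Icc] with t ht
    simpa using hM s hs t ht)

theorem coeFn_kerSection {s : ℝ} (hs : s ∈ Set.Icc (0 : ℝ) 1) :
    (κ.kerSection hs : ℝ → ℂ) =ᵐ[mu] fun t => (κ.ker (s, t) : ℂ) :=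
  MemLp.coeFn_toLp _

/-- Makes orthogonality of the projection available pointwise in `s`. No conjugate appears because
the kernel is real. -/
theorem integralFun_eq_inner {s : ℝ} (hs : s ∈ Set.Icc (0 : ℝ) 1) (x : L2) :
    κ.integralFun x s = inner ℂ (κ.kerSection hs) x := by
  rw [L2.inner_def]
  refine integral_congr_ae ?_
  filter_upwards [κ.coeFn_kerSection hs] with t ht
  rw [ht]
  simp [mul_comm]

end GreenKernel

/-! ### The uniform partition -/

section Cells

/-- The cell `(j/n, (j+1)/n]`. -/
abbrev cell (n j : ℕ) : Set ℝ := Set.Ioc ((j : ℝ) / n) (((j : ℝ) + 1) / n)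

theorem exists_mem_cell {n : ℕ} (hn : 0 < n) {t : ℝ} (ht : t ∈ Set.Ioc (0 : ℝ) 1) :
    ∃ j : Fin n, t ∈ cell n j := by
  have hn' : (0 : ℝ) < n := by exact_mod_cast hn
  have hpos : 0 < t * n := mul_pos ht.1 hn'
  have h1 : 1 ≤ ⌈t * n⌉₊ := Nat.one_le_iff_ne_zero.mpr (Nat.ceil_pos.mpr hpos).ne'
  have h2 : ⌈t * n⌉₊ ≤ n := Nat.ceil_le.mpr (by nlinarith [ht.2])
  -- Cells are closed on the right and indexed from zero, hence the ceiling minus one.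
  refine ⟨⟨⌈t * n⌉₊ - 1, by omega⟩, ?_, ?_⟩
  · rw [div_lt_iff₀ hn', Nat.cast_sub h1]
    have := Nat.ceil_lt_add_one hpos.le
    push_cast
    linarith
  · rw [le_div_iff₀ hn', Nat.cast_sub h1]
    push_cast
    linarith [Nat.le_ceil (t * n)]

theorem disjoint_cell {n : ℕ} (hn : 0 < n) {i j : ℕ} {t : ℝ} (hi : t ∈ cell n i)
    (hj : t ∈ cell n j) : i = j := by
  have hn' : (0 : ℝ) < n := by exact_mod_cast hn
  have h1 : (i : ℝ) < (j : ℝ) + 1 := (div_lt_div_iff_of_pos_right hn').mp (hi.1.trans_le hj.2)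
  have h2 : (j : ℝ) < (i : ℝ) + 1 := (div_lt_div_iff_of_pos_right hn').mp (hj.1.trans_le hi.2)
  norm_cast at h1 h2
  omega

/-- The point `0` belongs to no cell and has to be discarded. -/
theorem ae_mem_Ioc : ∀ᵐ t ∂mu, t ∈ Set.Ioc (0 : ℝ) 1 := by
  have : mu = volume.restrict (Set.Ioc (0 : ℝ) 1) := (restrict_Ioc_eq_restrict_Icc).symm
  rw [this]
  exact ae_restrict_mem measurableSet_Ioc

theorem cell_subset {n : ℕ} (j : Fin n) : cell n j ⊆ Set.Icc (0 : ℝ) 1 := fun t ht => by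
  have hn' : (0 : ℝ) < n := by exact_mod_cast j.pos
  have h1 : ((j : ℝ) + 1) / n ≤ 1 := by
    rw [div_le_one hn']
    exact_mod_cast j.2
  exact ⟨le_trans (by positivity) ht.1.le, ht.2.trans h1⟩

theorem piecewisePoly_apply {n : ℕ} (p : Fin n → ℂ[X]) {t : ℝ} {j : Fin n} (ht : t ∈ cell n j) :
    piecewisePoly n p t = (p j).eval (t : ℂ) := by
  rw [piecewisePoly, Finset.sum_eq_single j, Set.indicator_of_mem ht]
  · intro i _ hij
    refine Set.indicator_of_notMem (fun hi => hij ?_) _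
    exact Fin.ext (disjoint_cell j.pos hi ht)
  · simp

/-- The class of a piecewise polynomial function. -/
noncomputable def piecewiseLp (n : ℕ) (p : Fin n → ℂ[X]) : L2 := (memLp_piecewisePoly n p).toLp

theorem piecewiseLp_mem {r n : ℕ} {p : Fin n → ℂ[X]} (hp : ∀ j, (p j).natDegree ≤ 2 * r) :
    piecewiseLp n p ∈ approxSpace r n :=
  ⟨p, hp, MemLp.coeFn_toLp _⟩

/-- A function that is close to a polynomial of degree at most `2r` on each cell is close to a
piecewise polynomial. -/
theorem exists_approxSpace_near {r n : ℕ} (hn : 0 < n) {x : L2} {f : ℝ → ℂ} (hf : x =ᵐ[mu] f)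
    {B : ℝ → ℝ} (h : ∀ j : Fin n, ∃ q : ℂ[X], q.natDegree ≤ 2 * r ∧
      ∀ t ∈ cell n j, ‖f t - q.eval (t : ℂ)‖ ≤ B t) :
    ∃ y ∈ approxSpace r n, ∀ᵐ t ∂mu, ‖(x - y) t‖ ≤ B t := by
  choose p hp hpB using h
  refine ⟨piecewiseLp n p, piecewiseLp_mem hp, ?_⟩
  filter_upwards [hf, ae_mem_Ioc, Lp.coeFn_sub x (piecewiseLp n p),
    (memLp_piecewisePoly n p).coeFn_toLp] with t h1 h2 h3 h4
  obtain ⟨j, hj⟩ := exists_mem_cell hn h2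
  rw [h3, Pi.sub_apply, h1, piecewiseLp, h4, piecewisePoly_apply p hj]
  exact hpB j t hj

theorem setIntegral_cell {n : ℕ} (j : Fin n) (f : ℝ → ℝ) :
    ∫ t, (cell n j).indicator f t ∂mu = ∫ t in ((j : ℝ) / n)..(((j : ℝ) + 1) / n), f t := by
  rw [integral_indicator measurableSet_Ioc, Measure.restrict_restrict measurableSet_Ioc,
    Set.inter_eq_left.mpr (cell_subset j), intervalIntegral.integral_of_le]
  gcongr
  linarith

end Cells

/-! ### Sup norm against `L²` norm for polynomials of bounded degree -/

section InverseEstimate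

theorem memLp_pow (i : ℕ) : MemLp (fun t : ℝ => (t : ℂ) ^ i) 2 mu := by
  refine MemLp.of_bound (by fun_prop) 1 ?_
  filter_upwards [ae_restrict_mem measurableSet_Icc] with t ht
  rw [norm_pow, Complex.norm_real, Real.norm_of_nonneg ht.1]
  exact pow_le_one₀ ht.1 ht.2

theorem memLp_eval (q : ℂ[X]) : MemLp (fun t : ℝ => q.eval (t : ℂ)) 2 mu := by
  simp only [eval_eq_sum_range]
  exact memLp_finsetSum _ fun i _ => (memLp_pow i).const_mul _

theorem eq_zero_of_eval_ae_eq_zero {q : ℂ[X]} (h : ∀ᵐ t ∂mu, q.eval ((t : ℝ) : ℂ) = 0) : q = 0 := by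
  refine Polynomial.eq_zero_of_infinite_isRoot q ?_
  have hinf : {t : ℝ | q.eval (t : ℂ) = 0}.Infinite := by
    intro hfin
    have h0 : mu {t : ℝ | q.eval (t : ℂ) = 0} = 0 := hfin.measure_zero _
    have h1 : mu {t : ℝ | ¬ q.eval (t : ℂ) = 0} = 0 := h
    have h2 : mu Set.univ ≤ 0 := by
      rw [← Set.union_compl_self {t : ℝ | q.eval (t : ℂ) = 0}]
      exact (measure_union_le _ _).trans (by rw [h0, zero_add]; exact h1.le)
    simp at h2
  refine (hinf.image Complex.ofReal_injective.injOn).mono ?_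
  rintro _ ⟨t, ht, rfl⟩
  exact ht

/-- On the unit interval the sup norm of a polynomial is controlled by its `L²` norm. -/
theorem exists_eval_le_norm_toLp (d : ℕ) : ∃ C : ℝ, 0 < C ∧ ∀ q : ℂ[X], q.natDegree ≤ d →
    ∀ t ∈ Set.Icc (0 : ℝ) 1, ‖q.eval (t : ℂ)‖ ≤ C * ‖(memLp_eval q).toLp‖ := by
  let f : degreeLT ℂ (d + 1) →ₗ[ℂ] L2 :=
    { toFun := fun q => (memLp_eval q).toLp
      map_add' := fun p q => by
        rw [← MemLp.toLp_add]
        exact MemLp.toLp_congr _ _ (Eventually.of_forall fun t => by simp)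
      map_smul' := fun c p => by
        rw [RingHom.id_apply, ← MemLp.toLp_const_smul]
        exact MemLp.toLp_congr _ _ (Eventually.of_forall fun t => by simp) }
  let e := degreeLTEquiv ℂ (d + 1)
  have hinj : LinearMap.ker (f.comp e.symm.toLinearMap) = ⊥ := by
    rw [LinearMap.ker_eq_bot']
    intro c hc
    have h0 : (e.symm c : ℂ[X]) = 0 := eq_zero_of_eval_ae_eq_zero (by
      have h1 : (f (e.symm c) : ℝ → ℂ) =ᵐ[mu] fun t => (e.symm c : ℂ[X]).eval (t : ℂ) :=
        (memLp_eval _).coeFn_toLp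
      have h2 : f (e.symm c) = 0 := hc
      rw [h2] at h1
      filter_upwards [h1, Lp.coeFn_zero ℂ 2 mu] with t h3 h4
      rw [← h3, h4, Pi.zero_apply])
    exact e.symm.map_eq_zero_iff.mp (Subtype.ext h0)
  -- An injective linear map on a finite-dimensional space is bounded below, so the `L²` norm
  -- controls all coefficients; the `d + 1` monomials are then summed.
  obtain ⟨K, hK0, hK⟩ := LinearMap.exists_antilipschitzWith _ hinj
  refine ⟨(d + 1) * K, by positivity, fun q hq t ht => ?_⟩
  let q' : degreeLT ℂ (d + 1) := ⟨q, by
    rw [mem_degreeLT]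
    exact (degree_le_of_natDegree_le hq).trans_lt (by exact_mod_cast Nat.lt_succ_self _)⟩
  have h1 : ‖e q'‖ ≤ K * ‖(memLp_eval q).toLp‖ := by
    have := hK.le_mul_norm (map_zero _) (e q')
    simpa [f, e] using this
  have h2 : ∀ i ∈ Finset.range (d + 1), ‖q.coeff i * (t : ℂ) ^ i‖ ≤ ‖e q'‖ := fun i hi => by
    rw [norm_mul, norm_pow, Complex.norm_real, Real.norm_of_nonneg ht.1]
    have h3 : ‖q.coeff i‖ ≤ ‖e q'‖ := norm_le_pi_norm (e q') ⟨i, Finset.mem_range.mp hi⟩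
    exact (mul_le_of_le_one_right (norm_nonneg _) (pow_le_one₀ ht.1 ht.2)).trans h3
  rw [eval_eq_sum_range' (Nat.lt_succ_of_le hq)]
  refine (norm_sum_le_of_le _ h2).trans ?_
  rw [Finset.sum_const, Finset.card_range, nsmul_eq_mul, mul_assoc]
  push_cast
  gcongr

/-- The inverse estimate on an interval. -/
theorem exists_inverse_estimate (d : ℕ) : ∃ C : ℝ, 0 < C ∧ ∀ q : ℂ[X], q.natDegree ≤ d →
    ∀ a b : ℝ, a < b → ∀ t ∈ Set.Icc a b,
      ‖q.eval (t : ℂ)‖ ^ 2 * (b - a) ≤ C * ∫ u in a..b, ‖q.eval (u : ℂ)‖ ^ 2 := by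
  obtain ⟨C, hC0, hC⟩ := exists_eval_le_norm_toLp d
  refine ⟨C ^ 2, by positivity, fun q hq a b hab t ht => ?_⟩
  have hba : 0 < b - a := sub_pos.mpr hab
  -- Affine pull-back to `[0,1]`; the scaling produces the factor `b - a` and leaves the constant
  -- independent of the interval.
  set p : ℂ[X] := q.comp (Polynomial.C ((a : ℝ) : ℂ) + Polynomial.C (((b - a : ℝ)) : ℂ) * X) with hp
  have hpd : p.natDegree ≤ d := by
    refine natDegree_comp_le.trans ?_
    have : (Polynomial.C ((a : ℝ) : ℂ) + Polynomial.C (((b - a : ℝ)) : ℂ) * X).natDegree ≤ 1 := by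
      compute_degree
    nlinarith
  have hpe : ∀ u : ℝ, p.eval (u : ℂ) = q.eval ((a + (b - a) * u : ℝ) : ℂ) := fun u => by
    simp [hp]
  have h1 := hC p hpd ((t - a) / (b - a))
    ⟨div_nonneg (by linarith [ht.1]) hba.le, (div_le_one hba).mpr (by linarith [ht.2])⟩
  rw [hpe, mul_div_cancel₀ _ hba.ne', add_sub_cancel] at h1
  have h2 : ‖(memLp_eval p).toLp‖ ^ 2 = (b - a)⁻¹ * ∫ u in a..b, ‖q.eval (u : ℂ)‖ ^ 2 := by
    have h3 : ∫ u, ‖((memLp_eval p).toLp : L2) u‖ ^ 2 ∂mu =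
        ∫ u in (0 : ℝ)..1, ‖q.eval ((a + (b - a) * u : ℝ) : ℂ)‖ ^ 2 := by
      rw [intervalIntegral.integral_of_le zero_le_one, ← integral_Icc_eq_integral_Ioc]
      refine integral_congr_ae ?_
      filter_upwards [(memLp_eval p).coeFn_toLp] with u hu
      rw [hu, hpe]
    rw [norm_sq_eq_integral, h3,
      intervalIntegral.integral_comp_add_mul (fun u : ℝ => ‖q.eval (u : ℂ)‖ ^ 2) hba.ne']
    simp
  calc ‖q.eval (t : ℂ)‖ ^ 2 * (b - a)
      ≤ (C * ‖(memLp_eval p).toLp‖) ^ 2 * (b - a) := by gcongr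
    _ = C ^ 2 * ∫ u in a..b, ‖q.eval (u : ℂ)‖ ^ 2 := by
      rw [mul_pow, h2]; field_simp

end InverseEstimate

end GreenGalerkin

namespace GreenGalerkin

/-! ### Stability of the orthogonal projections in the sup norm -/

section Projection

variable {r n : ℕ}

theorem proj_apply_of_mem {y : L2} (hy : y ∈ approxSpace r n) : proj r n y = y :=
  Submodule.starProjection_eq_self_iff.mpr hy

theorem proj_mem (x : L2) : proj r n x ∈ approxSpace r n :=
  Submodule.starProjection_apply_mem _ _

theorem norm_sub_proj_le_norm_sub (x : L2) {y : L2} (hy : y ∈ approxSpace r n) :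
    ‖x - proj r n x‖ ≤ ‖x - y‖ := by
  rw [proj, Submodule.starProjection_minimal]
  exact ciInf_le ⟨0, by rintro _ ⟨z, rfl⟩; positivity⟩ (⟨y, hy⟩ : approxSpace r n)

theorem inner_sub_proj (x : L2) {y : L2} (hy : y ∈ approxSpace r n) :
    (inner ℂ y (x - proj r n x) : ℂ) = 0 := by
  rw [← inner_conj_symm, proj, Submodule.starProjection_inner_eq_zero x y hy, map_zero]

theorem eval_le_of_cell {B m h C I : ℝ} (hC : 0 < C) (hh : 0 < h) (hm : 0 ≤ m) (hB : 0 ≤ B)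
    (h1 : m ^ 2 * h ≤ C * I) (h2 : I ≤ B * m * h) : m ≤ C * B := by
  rcases hm.eq_or_lt with rfl | hm
  · positivity
  · have h3 : m * (m * h) ≤ C * B * (m * h) := by nlinarith
    exact le_of_mul_le_mul_right h3 (by positivity)

/-- The orthogonal projections onto the piecewise polynomials are uniformly bounded in the
supremum norm. -/
theorem exists_essBdd_proj (r : ℕ) : ∃ c : ℝ, 0 < c ∧ ∀ n : ℕ, 0 < n → ∀ (x : L2) (B : ℝ), 0 ≤ B →
    EssBdd x B → EssBdd (proj r n x) (c * B) := by
  obtain ⟨C, hC0, hC⟩ := exists_inverse_estimate (2 * r)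
  refine ⟨C, hC0, fun n hn x B hB hx => ?_⟩
  have hn' : (0 : ℝ) < n := by exact_mod_cast hn
  obtain ⟨p, hp, hy⟩ := proj_mem (r := r) (n := n) x
  have key : ∀ j : Fin n, ∀ t ∈ cell n j, ‖(p j).eval (t : ℂ)‖ ≤ C * B := by
    intro j t ht
    set a : ℝ := (j : ℝ) / n
    set b : ℝ := ((j : ℝ) + 1) / n
    have hab : a < b := by simp only [a, b]; gcongr; linarith
    -- The maximum is taken on the closed cell, where compactness applies.
    obtain ⟨t₀, ht₀, hmax⟩ := isCompact_Icc.exists_isMaxOn (Set.nonempty_Icc.mpr hab.le)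
      (f := fun u : ℝ => ‖(p j).eval (u : ℂ)‖) (by fun_prop)
    have hmax' : ∀ u ∈ Set.Icc a b, ‖(p j).eval (u : ℂ)‖ ≤ ‖(p j).eval (t₀ : ℂ)‖ :=
      fun u hu => hmax hu
    set m := ‖(p j).eval (t₀ : ℂ)‖
    refine (hmax' t (Set.Ioc_subset_Icc_self ht)).trans ?_
    refine eval_le_of_cell hC0 (sub_pos.mpr hab) (norm_nonneg _) hB (hC (p j) (hp j) a b hab t₀ ht₀) ?_
    -- Test function: the restriction `e` of `P x` to one cell. It lies in the approximation space
    -- because no continuity is imposed at the nodes, so `⟨e, e⟩ = ⟨e, P x⟩ = ⟨e, x⟩`, which is at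
    -- most `B` times the `L¹` norm of `e`. The inverse estimate closes the loop.
    set p' : Fin n → ℂ[X] := Pi.single j (p j) with hp'
    set e : L2 := piecewiseLp n p' with he
    have hemem : e ∈ approxSpace r n := piecewiseLp_mem fun i => by
      by_cases hij : i = j
      · subst hij; simpa [hp'] using hp i
      · simp [hp', hij]
    have hecell : ∀ᵐ u ∂mu, e u = (cell n j).indicator (fun u : ℝ => (p j).eval (u : ℂ)) u := by
      filter_upwards [(memLp_piecewisePoly n p').coeFn_toLp, ae_mem_Ioc] with u hu hu1
      obtain ⟨i, hi⟩ := exists_mem_cell hn hu1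
      rw [he, piecewiseLp, hu, piecewisePoly_apply p' hi]
      by_cases hij : i = j
      · subst hij; rw [Set.indicator_of_mem hi]; simp [hp']
      · rw [Set.indicator_of_notMem fun h => hij (Fin.ext (disjoint_cell hn hi h))]
        simp [hp', hij]
    have hnorm : ∫ u in a..b, ‖(p j).eval (u : ℂ)‖ ^ 2 = ‖e‖ ^ 2 := by
      rw [norm_sq_eq_integral, ← setIntegral_cell]
      refine integral_congr_ae ?_
      filter_upwards [hecell] with u hu
      rw [hu]
      by_cases h : u ∈ cell n j <;> simp [h]
    have hinner : (inner ℂ e e : ℂ) = inner ℂ e x := by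
      have h1 : (inner ℂ e (x - proj r n x) : ℂ) = 0 := inner_sub_proj x hemem
      have h2 : (inner ℂ e e : ℂ) = inner ℂ e (proj r n x) := by
        rw [L2.inner_def, L2.inner_def]
        refine integral_congr_ae ?_
        filter_upwards [hecell, hy] with u hu hyu
        rw [hyu, hu]
        by_cases h : u ∈ cell n j
        · rw [Set.indicator_of_mem h, piecewisePoly_apply p h]
        · simp [h]
      rw [h2, ← sub_eq_zero, ← neg_sub, ← inner_sub_right, h1, neg_zero]
    have hle : ‖(inner ℂ e x : ℂ)‖ ≤ B * m * (b - a) := by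
      refine (norm_inner_le_integral e x).trans ?_
      have h1 : ∫ u, (cell n j).indicator (fun _ => B * m) u ∂mu = B * m * (b - a) := by
        rw [setIntegral_cell, intervalIntegral.integral_const, smul_eq_mul, mul_comm]
      rw [← h1]
      refine integral_mono_ae ((Lp.memLp e).norm.integrable_mul (Lp.memLp x).norm)
        ((integrable_const _).indicator measurableSet_Ioc) ?_
      filter_upwards [hecell, hx] with u hu hxu
      rw [hu]
      by_cases h : u ∈ cell n j
      · rw [Set.indicator_of_mem h, Set.indicator_of_mem h, mul_comm B]
        exact mul_le_mul (hmax' u (Set.Ioc_subset_Icc_self h)) hxu (norm_nonneg _) (norm_nonneg _)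
      · simp [h]
    rw [hnorm]
    rw [← hinner, inner_self_eq_norm_sq_to_K, norm_pow] at hle
    simpa using hle
  filter_upwards [hy, ae_mem_Ioc] with t h1 h2
  obtain ⟨j, hj⟩ := exists_mem_cell hn h2
  rw [h1, piecewisePoly_apply p hj]
  exact key j t hj

/-- Since `I - P` annihilates `y`, it may be applied to `x - y`: the projection is quasi-optimal in
the sup norm. -/
theorem exists_essBdd_sub_proj (r : ℕ) : ∃ c : ℝ, 0 < c ∧ ∀ n : ℕ, 0 < n → ∀ (x y : L2) (B : ℝ),
    0 ≤ B → y ∈ approxSpace r n → EssBdd (x - y) B → EssBdd (x - proj r n x) (c * B) := by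
  obtain ⟨c, hc0, hc⟩ := exists_essBdd_proj r
  refine ⟨1 + c, by positivity, fun n hn x y B hB hy h => ?_⟩
  have h1 := h.sub (hc n hn (x - y) B hB h)
  have h2 : x - y - proj r n (x - y) = x - proj r n x := by
    rw [map_sub, proj_apply_of_mem hy]; abel
  rw [h2] at h1
  exact h1.mono (by linarith)

end Projection

end GreenGalerkin

namespace GreenGalerkin

/-! ### Taylor approximation on cells -/

section Taylor

/-- Taylor's theorem with a remainder bound that is uniform in the expansion point. -/
theorem exists_taylor_bound_Icc {E : Type*} [NormedAddCommGroup E] [NormedSpace ℝ E] {a b : ℝ}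
    (hab : a < b) (n : ℕ) {f : ℝ → E} (hf : ContDiffOn ℝ (n + 1 : ℕ) f (Set.Icc a b)) :
    ∃ C : ℝ, 0 ≤ C ∧ ∀ x₀ ∈ Set.Icc a b, ∀ x ∈ Set.Icc a b,
      ‖f x - taylorWithinEval f n (Set.Icc a b) x₀ x‖ ≤ C * |x - x₀| ^ (n + 1) := by
  induction n generalizing f with
  | zero =>
    obtain ⟨K, hK⟩ := hf.exists_lipschitzOnWith (by simp) (convex_Icc a b) isCompact_Icc
    refine ⟨K, K.2, fun x₀ hx₀ x hx => ?_⟩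
    rw [taylor_within_zero_eval]
    simpa using hK.norm_sub_le hx hx₀
  | succ n ih =>
    have hu := uniqueDiffOn_Icc hab
    have hf' : ContDiffOn ℝ ((n + 1 : ℕ) + 1) f (Set.Icc a b) := by exact_mod_cast hf
    obtain ⟨C, hC0, hC⟩ := ih (hf'.derivWithin hu le_rfl)
    refine ⟨C, hC0, fun x₀ hx₀ x hx => ?_⟩
    have hsub : Set.uIcc x₀ x ⊆ Set.Icc a b := Set.uIcc_subset_Icc hx₀ hx
    -- The derivative of the Taylor remainder of `f` is the remainder, one degree lower, of `f'`;
    -- the mean value inequality then adds one power of the distance.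
    have hd : ∀ y ∈ Set.uIcc x₀ x, HasDerivWithinAt
        (fun y => f y - taylorWithinEval f (n + 1) (Set.Icc a b) x₀ y)
        (derivWithin f (Set.Icc a b) y -
          taylorWithinEval (derivWithin f (Set.Icc a b)) n (Set.Icc a b) x₀ y)
        (Set.uIcc x₀ x) y := fun y hy => by
      refine HasDerivWithinAt.sub ?_ (hasDerivAt_taylorWithinEval_succ f n).hasDerivWithinAt
      exact ((hf.differentiableOn (by simp) _ (hsub hy)).hasDerivWithinAt).mono hsub
    have hb : ∀ y ∈ Set.uIcc x₀ x, ‖derivWithin f (Set.Icc a b) y -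
        taylorWithinEval (derivWithin f (Set.Icc a b)) n (Set.Icc a b) x₀ y‖ ≤
          C * |x - x₀| ^ (n + 1) := fun y hy => by
      refine (hC x₀ hx₀ y (hsub hy)).trans ?_
      have := Set.abs_sub_left_of_mem_uIcc hy
      gcongr
    have := (convex_uIcc x₀ x).norm_image_sub_le_of_norm_hasDerivWithin_le hd hb
      Set.left_mem_uIcc Set.right_mem_uIcc
    simpa [taylorWithinEval_self, pow_succ, mul_assoc] using this

/-- The Taylor polynomial of a complex function of a real variable. -/
theorem exists_polynomial_eq_taylorWithinEval (f : ℝ → ℂ) (n : ℕ) (s : Set ℝ) (x₀ : ℝ) :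
    ∃ q : ℂ[X], q.natDegree ≤ n ∧ ∀ x : ℝ, q.eval (x : ℂ) = taylorWithinEval f n s x₀ x := by
  refine ⟨∑ k ∈ Finset.range (n + 1), C (((k.factorial : ℝ)⁻¹ : ℝ) * iteratedDerivWithin k f s x₀) *
    (X - C (x₀ : ℂ)) ^ k, ?_, fun x => ?_⟩
  · refine natDegree_sum_le_of_forall_le _ _ fun k hk => (natDegree_C_mul_le _ _).trans ?_
    rw [natDegree_pow, natDegree_X_sub_C, mul_one]
    exact Nat.lt_succ_iff.mp (Finset.mem_range.mp hk)
  · rw [taylor_within_apply, eval_finsetSum]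
    refine Finset.sum_congr rfl fun k _ => ?_
    simp only [eval_mul, eval_C, eval_pow, eval_sub, eval_X, Complex.real_smul]
    push_cast
    ring

/-- Local polynomial approximation of a smooth function. -/
theorem exists_polynomial_approx {n : ℕ} {f : ℝ → ℂ}
    (hf : ContDiffOn ℝ (n + 1 : ℕ) f (Set.Icc 0 1)) :
    ∃ C : ℝ, 0 ≤ C ∧ ∀ a b : ℝ, a ∈ Set.Icc (0 : ℝ) 1 → b ∈ Set.Icc (0 : ℝ) 1 →
      ∃ q : ℂ[X], q.natDegree ≤ n ∧
        ∀ t ∈ Set.Icc a b, ‖f t - q.eval (t : ℂ)‖ ≤ C * (b - a) ^ (n + 1) := by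
  obtain ⟨C, hC0, hC⟩ := exists_taylor_bound_Icc zero_lt_one n hf
  refine ⟨C, hC0, fun a b ha hb => ?_⟩
  obtain ⟨q, hq, hqe⟩ := exists_polynomial_eq_taylorWithinEval f n (Set.Icc 0 1) a
  refine ⟨q, hq, fun t ht => ?_⟩
  rw [hqe]
  refine (hC a ha t ⟨ha.1.trans ht.1, ht.2.trans hb.2⟩).trans ?_
  rw [abs_of_nonneg (sub_nonneg.mpr ht.1)]
  have : 0 ≤ t - a := sub_nonneg.mpr ht.1
  gcongr
  exact ht.2

end Taylor

/-! ### Geometry of the two triangles -/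

section Triangles

theorem isClosed_lowerTriangle : IsClosed lowerTriangle :=
  (isClosed_le continuous_const continuous_snd).inter
    ((isClosed_le continuous_snd continuous_fst).inter
      (isClosed_le continuous_fst continuous_const))

theorem isClosed_upperTriangle : IsClosed upperTriangle :=
  (isClosed_le continuous_const continuous_fst).inter
    ((isClosed_le continuous_fst continuous_snd).inter
      (isClosed_le continuous_snd continuous_const))

theorem isCompact_lowerTriangle : IsCompact lowerTriangle :=
  (isCompact_Icc.prod isCompact_Icc).of_isClosed_subset isClosed_lowerTriangle
    fun _ hp => ⟨⟨hp.1.trans hp.2.1, hp.2.2⟩, hp.1, hp.2.1.trans hp.2.2⟩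

theorem isCompact_upperTriangle : IsCompact upperTriangle :=
  (isCompact_Icc.prod isCompact_Icc).of_isClosed_subset isClosed_upperTriangle
    fun _ hp => ⟨⟨hp.1, hp.2.1.trans hp.2.2⟩, hp.1.trans hp.2.1, hp.2.2⟩

theorem convex_lowerTriangle : Convex ℝ lowerTriangle := by
  rintro ⟨s, t⟩ ⟨h1, h2, h3⟩ ⟨s', t'⟩ ⟨h1', h2', h3'⟩ a b ha hb hab
  simp only at h1 h2 h3 h1' h2' h3'
  refine ⟨?_, ?_, ?_⟩ <;> simp only [Prod.smul_mk, Prod.mk_add_mk, smul_eq_mul]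
  · positivity
  · gcongr
  · nlinarith

theorem convex_upperTriangle : Convex ℝ upperTriangle := by
  rintro ⟨s, t⟩ ⟨h1, h2, h3⟩ ⟨s', t'⟩ ⟨h1', h2', h3'⟩ a b ha hb hab
  simp only at h1 h2 h3 h1' h2' h3'
  refine ⟨?_, ?_, ?_⟩ <;> simp only [Prod.smul_mk, Prod.mk_add_mk, smul_eq_mul]
  · positivity
  · gcongr
  · nlinarith

theorem uniqueDiffOn_lowerTriangle : UniqueDiffOn ℝ lowerTriangle := by
  refine uniqueDiffOn_convex convex_lowerTriangle ⟨(3 / 4, 1 / 4), ?_⟩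
  refine mem_interior.mpr ⟨{p | 0 < p.2 ∧ p.2 < p.1 ∧ p.1 < 1},
    fun p hp => ⟨hp.1.le, hp.2.1.le, hp.2.2.le⟩, ?_, by norm_num⟩
  exact (isOpen_lt continuous_const continuous_snd).inter
    ((isOpen_lt continuous_snd continuous_fst).inter
      (isOpen_lt continuous_fst continuous_const))

theorem uniqueDiffOn_upperTriangle : UniqueDiffOn ℝ upperTriangle := by
  refine uniqueDiffOn_convex convex_upperTriangle ⟨(1 / 4, 3 / 4), ?_⟩
  refine mem_interior.mpr ⟨{p | 0 < p.1 ∧ p.1 < p.2 ∧ p.2 < 1},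
    fun p hp => ⟨hp.1.le, hp.2.1.le, hp.2.2.le⟩, ?_, by norm_num⟩
  exact (isOpen_lt continuous_const continuous_fst).inter
    ((isOpen_lt continuous_fst continuous_snd).inter
      (isOpen_lt continuous_snd continuous_const))

end Triangles

/-! ### Smoothing by Volterra operators -/

section Volterra

/-- The Volterra operator `x ↦ ∫₀ˢ k(s,t) x(t) dt`. -/
noncomputable def volterra (k : ℝ × ℝ → ℂ) (x : ℝ → ℂ) (s : ℝ) : ℂ := ∫ t in (0 : ℝ)..s, k (s, t) * x t

theorem continuousOn_volterra {k : ℝ × ℝ → ℂ} {x : ℝ → ℂ} (hk : ContinuousOn k lowerTriangle)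
    (hx : ContinuousOn x (Set.Icc 0 1)) : ContinuousOn (volterra k x) (Set.Icc 0 1) := by
  -- Clamping `s` to `[0,1]` and `t` to `[0, c s]` gives a continuous integrand on the whole plane
  -- that agrees with the original one on the triangle.
  let c : ℝ → ℝ := fun s => max 0 (min s 1)
  let d : ℝ → ℝ → ℝ := fun s t => max 0 (min t (c s))
  have hc01 : ∀ s, c s ∈ Set.Icc (0 : ℝ) 1 := fun s =>
    ⟨le_max_left _ _, max_le zero_le_one (min_le_right _ _)⟩
  have hd : ∀ s t, (c s, d s t) ∈ lowerTriangle := fun s t =>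
    ⟨le_max_left _ _, max_le (hc01 s).1 (min_le_right _ _), (hc01 s).2⟩
  let F : ℝ → ℝ → ℂ := fun s t => k (c s, d s t) * x (d s t)
  have hF : Continuous F.uncurry := by
    refine Continuous.mul ?_ ?_
    · exact hk.comp_continuous (f := fun p : ℝ × ℝ => (c p.1, d p.1 p.2)) (by fun_prop)
        fun p => hd p.1 p.2
    · exact hx.comp_continuous (f := fun p : ℝ × ℝ => d p.1 p.2) (by fun_prop)
        fun p => ⟨(hd p.1 p.2).1, (hd p.1 p.2).2.1.trans (hd p.1 p.2).2.2⟩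
  have h := intervalIntegral.continuous_parametric_intervalIntegral_of_continuous (μ := volume)
    (a₀ := 0) hF continuous_id
  refine h.continuousOn.congr fun s hs => ?_
  refine intervalIntegral.integral_congr fun t ht => ?_
  rw [Set.uIcc_of_le hs.1] at ht
  have h1 : c s = s := by simp [c, hs.1, hs.2]
  have h2 : d s t = t := by simp [d, h1, ht.1, ht.2]
  simp only [F, h1, h2]

/-- The partial derivative in the first variable on the lower triangle. -/
noncomputable def lowerPartial (k : ℝ × ℝ → ℂ) (p : ℝ × ℝ) : ℂ := fderivWithin ℝ k lowerTriangle p (1, 0)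

theorem contDiffOn_lowerPartial {k : ℝ × ℝ → ℂ} {m : ℕ}
    (hk : ContDiffOn ℝ (m + 1 : ℕ) k lowerTriangle) :
    ContDiffOn ℝ m (lowerPartial k) lowerTriangle := by
  have h : ContDiffOn ℝ m (fderivWithin ℝ k lowerTriangle) lowerTriangle :=
    hk.fderivWithin uniqueDiffOn_lowerTriangle (by norm_cast)
  exact h.clm_apply contDiffOn_const

theorem integral_lowerPartial {k : ℝ × ℝ → ℂ} (hk : ContDiffOn ℝ 1 k lowerTriangle) {s t : ℝ}
    (ht : 0 ≤ t) (hts : t ≤ s) (hs : s ≤ 1) :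
    ∫ σ in t..s, lowerPartial k (σ, t) = k (s, t) - k (t, t) := by
  have hmaps : Set.MapsTo (fun σ : ℝ => (σ, t)) (Set.Icc t s) lowerTriangle :=
    fun σ hσ => ⟨ht, hσ.1, hσ.2.trans hs⟩
  have hcont := (contDiffOn_lowerPartial (m := 0) (by simpa using hk)).continuousOn
  refine intervalIntegral.integral_eq_sub_of_hasDerivAt_of_le hts
    (f := fun σ => k (σ, t)) (hk.continuousOn.comp (by fun_prop) hmaps) (fun σ hσ => ?_) ?_
  · have h1 : HasFDerivWithinAt k (fderivWithin ℝ k lowerTriangle (σ, t)) lowerTriangle (σ, t) :=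
      (hk.differentiableOn one_ne_zero _ (hmaps (Set.Ioo_subset_Icc_self hσ))).hasFDerivWithinAt
    have h2 : HasDerivWithinAt (fun σ : ℝ => (σ, t)) ((1 : ℝ), (0 : ℝ)) (Set.Icc t s) σ :=
      ((hasDerivAt_id σ).prodMk (hasDerivAt_const σ t)).hasDerivWithinAt
    exact (h1.comp_hasDerivWithinAt σ h2 hmaps).hasDerivAt (Icc_mem_nhds hσ.1 hσ.2)
  · refine ContinuousOn.intervalIntegrable ?_
    rw [Set.uIcc_of_le hts]
    exact hcont.comp (by fun_prop) hmaps

/-- Fubini over the triangle: integrating `∂₁k(σ,t) x(t)` first in `σ` from `t` to `s` leaves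
`(k(s,t) - k(t,t)) x(t)`, and the diagonal term restores the rest. The derivative can then be read
off by the fundamental theorem, with `x` only continuous. -/
theorem volterra_eq_integral {k : ℝ × ℝ → ℂ} {x : ℝ → ℂ} (hk : ContDiffOn ℝ 1 k lowerTriangle)
    (hx : ContinuousOn x (Set.Icc 0 1)) {s : ℝ} (hs : s ∈ Set.Icc (0 : ℝ) 1) :
    volterra k x s =
      ∫ σ in (0 : ℝ)..s, (k (σ, σ) * x σ + volterra (lowerPartial k) x σ) := by
  have hp := (contDiffOn_lowerPartial (m := 0) (by simpa using hk)).continuousOn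
  have hIcc : Set.Icc 0 s ⊆ Set.Icc (0 : ℝ) 1 := Set.Icc_subset_Icc_right hs.2
  have hdiag : ContinuousOn (fun σ => k (σ, σ) * x σ) (Set.Icc 0 s) :=
    (hk.continuousOn.comp (by fun_prop) fun σ hσ => ⟨hσ.1, le_rfl, hσ.2.trans hs.2⟩).mul
      (hx.mono hIcc)
  have hdiagI : IntervalIntegrable (fun σ => k (σ, σ) * x σ) volume 0 s :=
    ContinuousOn.intervalIntegrable (by rwa [Set.uIcc_of_le hs.1])
  have hVI : IntervalIntegrable (volterra (lowerPartial k) x) volume 0 s :=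
    ContinuousOn.intervalIntegrable (by
      rw [Set.uIcc_of_le hs.1]; exact (continuousOn_volterra hp hx).mono hIcc)
  let ν : Measure ℝ := volume.restrict (Set.Ioc 0 s)
  let F : ℝ → ℝ → ℂ := fun σ t =>
    lowerTriangle.indicator (fun p : ℝ × ℝ => lowerPartial k p * x p.2) (σ, t)
  have hFI : Integrable F.uncurry (ν.prod ν) := by
    have hc : ContinuousOn (fun p : ℝ × ℝ => lowerPartial k p * x p.2) lowerTriangle :=
      hp.mul (hx.comp (by fun_prop) fun p hp => ⟨hp.1, hp.2.1.trans hp.2.2⟩)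
    have h1 := hc.integrableOn_compact (μ := (volume : Measure (ℝ × ℝ))) isCompact_lowerTriangle
    have h2 := (integrable_indicator_iff isClosed_lowerTriangle.measurableSet).mpr h1
    rw [Measure.prod_restrict]
    exact h2.restrict
  have hinner1 : ∀ σ ∈ Set.Ioc 0 s, ∫ t, F σ t ∂ν = volterra (lowerPartial k) x σ := by
    intro σ hσ
    rw [volterra, intervalIntegral.integral_of_le hσ.1.le]
    have : ∀ t, (Set.Ioc 0 s).indicator (F σ) t =
        (Set.Ioc 0 σ).indicator (fun t => lowerPartial k (σ, t) * x t) t := fun t => by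
      by_cases h : t ∈ Set.Ioc 0 σ
      · rw [Set.indicator_of_mem h, Set.indicator_of_mem (s := Set.Ioc 0 s) ⟨h.1, h.2.trans hσ.2⟩]
        have hT : (σ, t) ∈ lowerTriangle := ⟨h.1.le, h.2, hσ.2.trans hs.2⟩
        exact Set.indicator_of_mem hT _
      · rw [Set.indicator_of_notMem h]
        by_cases h' : t ∈ Set.Ioc 0 s
        · rw [Set.indicator_of_mem h']
          refine Set.indicator_of_notMem (fun hT : (σ, t) ∈ lowerTriangle => h ⟨h'.1, hT.2.1⟩) _
        · rw [Set.indicator_of_notMem h']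
    rw [← integral_indicator measurableSet_Ioc, ← integral_indicator measurableSet_Ioc]
    exact integral_congr_ae (Eventually.of_forall this)
  have hinner2 : ∀ t ∈ Set.Ioc 0 s, ∫ σ, F σ t ∂ν = (k (s, t) - k (t, t)) * x t := by
    intro t ht
    rw [← integral_lowerPartial hk ht.1.le ht.2 hs.2, ← intervalIntegral.integral_mul_const,
      intervalIntegral.integral_of_le ht.2, ← integral_Icc_eq_integral_Ioc (x := t) (y := s)]
    have : ∀ σ, (Set.Ioc 0 s).indicator (fun σ => F σ t) σ =
        (Set.Icc t s).indicator (fun σ => lowerPartial k (σ, t) * x t) σ := fun σ => by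
      by_cases h : σ ∈ Set.Icc t s
      · rw [Set.indicator_of_mem h, Set.indicator_of_mem (s := Set.Ioc 0 s) ⟨ht.1.trans_le h.1, h.2⟩]
        have hT : (σ, t) ∈ lowerTriangle := ⟨ht.1.le, h.1, h.2.trans hs.2⟩
        exact Set.indicator_of_mem hT _
      · rw [Set.indicator_of_notMem h]
        by_cases h' : σ ∈ Set.Ioc 0 s
        · rw [Set.indicator_of_mem h']
          refine Set.indicator_of_notMem (fun hT : (σ, t) ∈ lowerTriangle => h ⟨hT.2.1, h'.2⟩) _
        · rw [Set.indicator_of_notMem h']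
    rw [← integral_indicator measurableSet_Ioc, ← integral_indicator measurableSet_Icc]
    exact integral_congr_ae (Eventually.of_forall this)
  have hswap := integral_integral_swap hFI
  rw [setIntegral_congr_fun measurableSet_Ioc hinner1,
    setIntegral_congr_fun measurableSet_Ioc hinner2, ← intervalIntegral.integral_of_le hs.1,
    ← intervalIntegral.integral_of_le hs.1] at hswap
  rw [intervalIntegral.integral_add hdiagI hVI, hswap, volterra, ← intervalIntegral.integral_add hdiagI]
  · exact intervalIntegral.integral_congr fun t _ => by ring
  · refine ContinuousOn.intervalIntegrable ?_
    rw [Set.uIcc_of_le hs.1]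
    simp only [sub_mul]
    refine ContinuousOn.sub ?_ hdiag
    exact (hk.continuousOn.comp (by fun_prop) fun t ht => ⟨ht.1, ht.2, hs.2⟩).mul (hx.mono hIcc)

theorem hasDerivWithinAt_volterra {k : ℝ × ℝ → ℂ} {x : ℝ → ℂ}
    (hk : ContDiffOn ℝ 1 k lowerTriangle) (hx : ContinuousOn x (Set.Icc 0 1)) {s : ℝ}
    (hs : s ∈ Set.Icc (0 : ℝ) 1) :
    HasDerivWithinAt (volterra k x) (k (s, s) * x s + volterra (lowerPartial k) x s)
      (Set.Icc 0 1) s := by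
  have hp := (contDiffOn_lowerPartial (m := 0) (by simpa using hk)).continuousOn
  set G : ℝ → ℂ := fun σ => k (σ, σ) * x σ + volterra (lowerPartial k) x σ with hG
  have hGc : ContinuousOn G (Set.Icc 0 1) :=
    ((hk.continuousOn.comp (by fun_prop) fun σ hσ => ⟨hσ.1, le_rfl, hσ.2⟩).mul hx).add
      (continuousOn_volterra hp hx)
  -- A continuous extension beyond `[0,1]` gives a two-sided derivative, which covers the endpoints
  -- too.
  have hE : Continuous (Set.IccExtend (zero_le_one (α := ℝ)) ((Set.Icc 0 1).domRestrict G)) :=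
    hGc.domRestrict.Icc_extend'
  have hd : HasDerivAt (fun u => ∫ σ in (0 : ℝ)..u,
      Set.IccExtend (zero_le_one (α := ℝ)) ((Set.Icc 0 1).domRestrict G) σ)
      (Set.IccExtend (zero_le_one (α := ℝ)) ((Set.Icc 0 1).domRestrict G) s) s :=
    intervalIntegral.integral_hasDerivAt_right (hE.intervalIntegrable _ _)
      hE.stronglyMeasurable.stronglyMeasurableAtFilter hE.continuousAt
  have hEG : ∀ u ∈ Set.Icc (0 : ℝ) 1,
      Set.IccExtend (zero_le_one (α := ℝ)) ((Set.Icc 0 1).domRestrict G) u = G u := fun u hu => by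
    rw [Set.IccExtend_of_mem _ _ hu]; rfl
  rw [hEG s hs] at hd
  refine hd.hasDerivWithinAt.congr_of_mem (fun u hu => ?_) hs
  rw [volterra_eq_integral hk hx hu]
  refine intervalIntegral.integral_congr fun σ hσ => ?_
  rw [Set.uIcc_of_le hu.1] at hσ
  exact (hEG σ ⟨hσ.1, hσ.2.trans hu.2⟩).symm

/-- The Volterra operator gains one derivative. -/
theorem contDiffOn_volterra {x : ℝ → ℂ} {j : ℕ} (hx : ContDiffOn ℝ j x (Set.Icc 0 1)) (m : ℕ)
    (hm : m ≤ j + 1) {k : ℝ × ℝ → ℂ} (hk : ContDiffOn ℝ m k lowerTriangle) :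
    ContDiffOn ℝ m (volterra k x) (Set.Icc 0 1) := by
  induction m generalizing k with
  | zero =>
    simp only [Nat.cast_zero, contDiffOn_zero] at hk ⊢
    exact continuousOn_volterra hk hx.continuousOn
  | succ m ih =>
    have hk1 : ContDiffOn ℝ 1 k lowerTriangle := hk.of_le (by norm_cast; omega)
    have hd := fun s hs => hasDerivWithinAt_volterra hk1 hx.continuousOn (s := s) hs
    have hu := uniqueDiffOn_Icc (zero_lt_one (α := ℝ))
    rw [Nat.cast_succ, contDiffOn_succ_iff_derivWithin hu]
    refine ⟨fun s hs => (hd s hs).differentiableWithinAt, by simp, ?_⟩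
    -- Only the diagonal term limits the gain: it is as smooth as `x`, whence the bound `m ≤ j` at
    -- this stage. The other term is again a Volterra integral, with one derivative of the kernel
    -- spent.
    have h1 : ContDiffOn ℝ m (fun s => k (s, s) * x s) (Set.Icc 0 1) := by
      refine ContDiffOn.mul ?_ (hx.of_le (by norm_cast; omega))
      exact (hk.of_le (by norm_cast; omega)).comp (f := fun s : ℝ => (s, s))
        (contDiff_id.prodMk contDiff_id).contDiffOn fun s hs => ⟨hs.1, le_rfl, hs.2⟩
    refine (h1.add (ih (by omega) (contDiffOn_lowerPartial hk))).congr fun s hs => ?_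
    exact (hd s hs).derivWithin (hu s hs)

end Volterra

end GreenGalerkin

/-! ### Regularity of Green's kernels and of eigenfunctions -/

namespace GreenGalerkin

/-- If `s` separates the two points, pass through `g s`; the two lengths add up to the whole
distance, so the constant does not grow. -/
theorem dist_le_of_glue {g : ℝ → ℝ} {L s : ℝ} (hs : s ∈ Set.Icc (0 : ℝ) 1)
    (h1 : ∀ t ∈ Set.Icc 0 s, ∀ t' ∈ Set.Icc 0 s, |g t - g t'| ≤ L * |t - t'|)
    (h2 : ∀ t ∈ Set.Icc s 1, ∀ t' ∈ Set.Icc s 1, |g t - g t'| ≤ L * |t - t'|) :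
    ∀ t ∈ Set.Icc (0 : ℝ) 1, ∀ t' ∈ Set.Icc (0 : ℝ) 1, |g t - g t'| ≤ L * |t - t'| := by
  have key : ∀ t ∈ Set.Icc (0 : ℝ) 1, ∀ t' ∈ Set.Icc (0 : ℝ) 1, t ≤ t' →
      |g t - g t'| ≤ L * |t - t'| := by
    intro t ht t' ht' htt
    rcases le_total t' s with h | h
    · exact h1 t ⟨ht.1, htt.trans h⟩ t' ⟨ht'.1, h⟩
    · rcases le_total s t with h' | h'
      · exact h2 t ⟨h', ht.2⟩ t' ⟨h, ht'.2⟩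
      · have e1 := h1 t ⟨ht.1, h'⟩ s ⟨hs.1, le_rfl⟩
        have e2 := h2 s ⟨le_rfl, hs.2⟩ t' ⟨h, ht'.2⟩
        have e3 := abs_sub_le (g t) (g s) (g t')
        rw [abs_sub_comm t s, abs_of_nonneg (sub_nonneg.mpr h')] at e1
        rw [abs_sub_comm s t', abs_of_nonneg (sub_nonneg.mpr h)] at e2
        rw [abs_sub_comm t t', abs_of_nonneg (sub_nonneg.mpr htt)]
        linarith
  intro t ht t' ht'
  rcases le_total t t' with h | h
  · exact key t ht t' ht' h
  · rw [abs_sub_comm (g t), abs_sub_comm t]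
    exact key t' ht' t ht h

/-- First-order Taylor expansion in `t`. The constant is the Lipschitz constant of the derivative on
all of `T`, which makes it uniform in `s`. -/
theorem exists_linear_approx {T : Set (ℝ × ℝ)} (hT : Convex ℝ T) (hTc : IsCompact T)
    (hTu : UniqueDiffOn ℝ T) {k : ℝ × ℝ → ℝ} (hk : ContDiffOn ℝ 2 k T) :
    ∃ A : ℝ, 0 ≤ A ∧ ∀ s a b : ℝ, a ≤ b → (∀ t ∈ Set.Icc a b, (s, t) ∈ T) →
      ∃ q : ℂ[X], q.natDegree ≤ 1 ∧
        ∀ t ∈ Set.Icc a b, ‖(k (s, t) : ℂ) - q.eval (t : ℂ)‖ ≤ A * (b - a) ^ 2 := by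
  have hf : ContDiffOn ℝ 1 (fderivWithin ℝ k T) T := hk.fderivWithin hTu (by norm_num)
  obtain ⟨L, hL⟩ := hf.exists_lipschitzOnWith one_ne_zero hT hTc
  refine ⟨L, L.2, fun s a b hab hsub => ?_⟩
  have ha : (s, a) ∈ T := hsub a (Set.left_mem_Icc.mpr hab)
  set φ := fderivWithin ℝ k T (s, a) with hφ
  refine ⟨C (k (s, a) : ℂ) + C (φ (0, 1) : ℂ) * (X - C (a : ℂ)), by compute_degree, fun t ht => ?_⟩
  have hS : ({s} : Set ℝ) ×ˢ Set.Icc a b ⊆ T := by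
    rintro ⟨s', t'⟩ ⟨hs', ht'⟩
    obtain rfl : s' = s := hs'
    exact hsub t' ht'
  have h1 := ((convex_singleton s).prod (convex_Icc a b)).norm_image_sub_le_of_norm_hasFDerivWithin_le'
    (f := k) (f' := fderivWithin ℝ k T) (C := L * (b - a)) (φ := φ) (x := (s, a)) (y := (s, t))
    (fun p hp => ((hk.differentiableOn two_ne_zero p (hS hp)).hasFDerivWithinAt).mono hS)
    (fun p hp => by
      refine (hL.norm_sub_le (hS hp) ha).trans ?_
      obtain ⟨s', t'⟩ := p
      obtain ⟨rfl, ht'⟩ := hp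
      have : ‖(s', t') - (s', a)‖ = t' - a := by
        simp [Prod.norm_def, abs_of_nonneg (sub_nonneg.mpr ht'.1), ht'.1]
      rw [this]
      gcongr
      exact ht'.2)
    ⟨rfl, Set.left_mem_Icc.mpr hab⟩ ⟨rfl, ht⟩
  have h2 : (s, t) - (s, a) = (t - a) • ((0 : ℝ), (1 : ℝ)) := by simp
  have h3 : ‖(s, t) - (s, a)‖ = t - a := by
    simp [Prod.norm_def, abs_of_nonneg (sub_nonneg.mpr ht.1), ht.1]
  rw [h3, h2, map_smul] at h1
  have h4 : (k (s, t) : ℂ) - (C (k (s, a) : ℂ) + C (φ (0, 1) : ℂ) * (X - C (a : ℂ))).eval (t : ℂ) =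
      ((k (s, t) - k (s, a) - (t - a) • φ (0, 1) : ℝ) : ℂ) := by
    simp only [eval_add, eval_C, eval_mul, eval_sub, eval_X, smul_eq_mul]
    push_cast
    ring
  rw [h4, Complex.norm_real]
  refine h1.trans ?_
  rw [sq, ← mul_assoc]
  have := L.2
  have hba := sub_nonneg.mpr hab
  gcongr
  exact ht.2

namespace GreenKernel

variable {α : ℕ} (κ : GreenKernel α)

theorem ker_of_mem_lower {p : ℝ × ℝ} (hp : p ∈ lowerTriangle) : κ.ker p = κ.lower p :=
  if_pos hp.2.1

theorem ker_of_mem_upper {p : ℝ × ℝ} (hp : p ∈ upperTriangle) : κ.ker p = κ.upper p := by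
  obtain ⟨s, t⟩ := p
  obtain ⟨h0, h1, h2⟩ := hp
  dsimp only at h0 h1 h2
  by_cases h : t ≤ s
  · obtain rfl : s = t := le_antisymm h1 h
    simpa [ker] using κ.diagonal s ⟨h0, h2⟩
  · simp [ker, h]

/-- A Green's kernel of class `C¹` is Lipschitz in each variable. -/
theorem exists_lipschitz (hα : 1 ≤ α) : ∃ L : ℝ, 0 ≤ L ∧ ∀ s ∈ Set.Icc (0 : ℝ) 1,
    ∀ t ∈ Set.Icc (0 : ℝ) 1, ∀ t' ∈ Set.Icc (0 : ℝ) 1,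
      |κ.ker (s, t) - κ.ker (s, t')| ≤ L * |t - t'| ∧
        |κ.ker (t, s) - κ.ker (t', s)| ≤ L * |t - t'| := by
  have hα' : ((α : ℕ) : WithTop ℕ∞) ≠ 0 := by exact_mod_cast (by omega : α ≠ 0)
  obtain ⟨K₁, h₁⟩ := κ.contDiffOn_lower.exists_lipschitzOnWith hα' convex_lowerTriangle
    isCompact_lowerTriangle
  obtain ⟨K₂, h₂⟩ := κ.contDiffOn_upper.exists_lipschitzOnWith hα' convex_upperTriangle
    isCompact_upperTriangle
  have hl : ∀ p ∈ lowerTriangle, ∀ q ∈ lowerTriangle,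
      |κ.ker p - κ.ker q| ≤ max K₁ K₂ * ‖p - q‖ := fun p hp q hq => by
    rw [κ.ker_of_mem_lower hp, κ.ker_of_mem_lower hq]
    refine (h₁.norm_sub_le hp hq).trans ?_
    gcongr
    exact le_max_left _ _
  have hu : ∀ p ∈ upperTriangle, ∀ q ∈ upperTriangle,
      |κ.ker p - κ.ker q| ≤ max K₁ K₂ * ‖p - q‖ := fun p hp q hq => by
    rw [κ.ker_of_mem_upper hp, κ.ker_of_mem_upper hq]
    refine (h₂.norm_sub_le hp hq).trans ?_
    gcongr
    exact le_max_right _ _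
  refine ⟨(max K₁ K₂ : NNReal), NNReal.coe_nonneg _, fun s hs t ht t' ht' => ⟨?_, ?_⟩⟩
  · have hn : ∀ a b : ℝ, ‖(s, a) - (s, b)‖ = |a - b| := fun a b => by simp [Prod.norm_def]
    refine dist_le_of_glue (g := fun t => κ.ker (s, t)) hs (fun t ht t' ht' => ?_)
      (fun t ht t' ht' => ?_) t ht t' ht'
    · simpa only [hn] using hl (s, t) ⟨ht.1, ht.2, hs.2⟩ (s, t') ⟨ht'.1, ht'.2, hs.2⟩
    · simpa only [hn] using hu (s, t) ⟨hs.1, ht.1, ht.2⟩ (s, t') ⟨hs.1, ht'.1, ht'.2⟩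
  · have hn : ∀ a b : ℝ, ‖(a, s) - (b, s)‖ = |a - b| := fun a b => by simp [Prod.norm_def]
    refine dist_le_of_glue (g := fun t => κ.ker (t, s)) hs (fun t ht t' ht' => ?_)
      (fun t ht t' ht' => ?_) t ht t' ht'
    · simpa only [hn] using hu (t, s) ⟨ht.1, ht.2, hs.2⟩ (t', s) ⟨ht'.1, ht'.2, hs.2⟩
    · simpa only [hn] using hl (t, s) ⟨hs.1, ht.1, ht.2⟩ (t', s) ⟨hs.1, ht'.1, ht'.2⟩

/-- Images under the integral operator are Lipschitz functions. -/
theorem exists_norm_integralFun_sub_le (hα : 1 ≤ α) : ∃ L : ℝ, 0 ≤ L ∧ ∀ x : L2,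
    ∀ s ∈ Set.Icc (0 : ℝ) 1, ∀ s' ∈ Set.Icc (0 : ℝ) 1,
      ‖κ.integralFun x s - κ.integralFun x s'‖ ≤ L * ‖x‖ * |s - s'| := by
  obtain ⟨L, hL0, hL⟩ := κ.exists_lipschitz hα
  refine ⟨L, hL0, fun x s hs s' hs' => ?_⟩
  have h : ‖κ.kerSection hs - κ.kerSection hs'‖ ≤ L * |s - s'| := by
    refine EssBdd.norm_le (by positivity) ?_
    filter_upwards [κ.coeFn_kerSection hs, κ.coeFn_kerSection hs',
      Lp.coeFn_sub (κ.kerSection hs) (κ.kerSection hs'), ae_restrict_mem measurableSet_Icc]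
      with t h1 h2 h3 ht
    rw [h3, Pi.sub_apply, h1, h2, ← Complex.ofReal_sub, Complex.norm_real]
    exact (hL t ht s hs s' hs').2
  rw [κ.integralFun_eq_inner hs, κ.integralFun_eq_inner hs', ← inner_sub_left]
  refine (norm_inner_le_norm _ _).trans ?_
  rw [mul_right_comm]
  gcongr

theorem continuousOn_integralFun (hα : 1 ≤ α) (x : L2) :
    ContinuousOn (κ.integralFun x) (Set.Icc 0 1) := by
  obtain ⟨L, hL0, hL⟩ := κ.exists_norm_integralFun_sub_le hα
  refine (LipschitzOnWith.of_dist_le_mul (K := ⟨L * ‖x‖, by positivity⟩)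
    fun s hs s' hs' => ?_).continuousOn
  rw [dist_eq_norm, Real.dist_eq]
  exact hL x s hs s' hs'

/-- The reflection `(s,t) ↦ (1 - s, 1 - t)` carries the upper triangle onto the lower one, so a
single Volterra theory serves both branches. -/
theorem integralFun_eq_volterra {x : ℝ → ℂ} (hx : ContinuousOn x (Set.Icc 0 1)) {s : ℝ}
    (hs : s ∈ Set.Icc (0 : ℝ) 1) :
    κ.integralFun x s = volterra (fun p => (κ.lower p : ℂ)) x s +
      volterra (fun p => (κ.upper (1 - p.1, 1 - p.2) : ℂ)) (fun t => x (1 - t)) (1 - s) := by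
  have hc : ContinuousOn (fun t => (κ.ker (s, t) : ℂ) * x t) (Set.Icc 0 1) :=
    (Complex.continuous_ofReal.comp_continuousOn
      (κ.continuousOn_ker.comp (by fun_prop) fun t ht => ⟨hs, ht⟩)).mul hx
  have h1 : IntervalIntegrable (fun t => (κ.ker (s, t) : ℂ) * x t) volume 0 s :=
    ContinuousOn.intervalIntegrable (hc.mono (by
      rw [Set.uIcc_of_le hs.1]; exact Set.Icc_subset_Icc_right hs.2))
  have h2 : IntervalIntegrable (fun t => (κ.ker (s, t) : ℂ) * x t) volume s 1 :=
    ContinuousOn.intervalIntegrable (hc.mono (by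
      rw [Set.uIcc_of_le hs.2]; exact Set.Icc_subset_Icc_left hs.1))
  rw [integralFun, integral_Icc_eq_integral_Ioc, ← intervalIntegral.integral_of_le zero_le_one,
    ← intervalIntegral.integral_add_adjacent_intervals h1 h2]
  congr 1
  · refine intervalIntegral.integral_congr fun t ht => ?_
    rw [Set.uIcc_of_le hs.1] at ht
    have hT : (s, t) ∈ lowerTriangle := ⟨ht.1, ht.2, hs.2⟩
    simp only [κ.ker_of_mem_lower hT]
  · have h3 := intervalIntegral.integral_comp_sub_left (a := 0) (b := 1 - s)
      (fun t => (κ.upper (s, t) : ℂ) * x t) 1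
    rw [sub_sub_cancel, sub_zero] at h3
    simp only [volterra, sub_sub_cancel]
    rw [h3]
    refine intervalIntegral.integral_congr fun t ht => ?_
    rw [Set.uIcc_of_le hs.2] at ht
    have hT : (s, t) ∈ upperTriangle := ⟨hs.1, ht.1, ht.2⟩
    simp only [κ.ker_of_mem_upper hT]

theorem contDiffOn_integralFun {x : ℝ → ℂ} {j : ℕ} (hj : j + 1 ≤ α)
    (hx : ContDiffOn ℝ j x (Set.Icc 0 1)) :
    ContDiffOn ℝ (j + 1 : ℕ) (κ.integralFun x) (Set.Icc 0 1) := by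
  have hle : ((j + 1 : ℕ) : WithTop ℕ∞) ≤ α := by exact_mod_cast hj
  have hmaps : Set.MapsTo (fun t : ℝ => 1 - t) (Set.Icc 0 1) (Set.Icc 0 1) :=
    fun t ht => ⟨sub_nonneg.mpr ht.2, by linarith [ht.1]⟩
  have hl : ContDiffOn ℝ (j + 1 : ℕ) (fun p => (κ.lower p : ℂ)) lowerTriangle :=
    Complex.ofRealCLM.contDiff.comp_contDiffOn (κ.contDiffOn_lower.of_le hle)
  have hu : ContDiffOn ℝ (j + 1 : ℕ) (fun p : ℝ × ℝ => (κ.upper (1 - p.1, 1 - p.2) : ℂ))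
      lowerTriangle := by
    refine Complex.ofRealCLM.contDiff.comp_contDiffOn ?_
    refine (κ.contDiffOn_upper.of_le hle).comp (f := fun p : ℝ × ℝ => (1 - p.1, 1 - p.2))
      (by fun_prop) fun p hp => ?_
    obtain ⟨h1, h2, h3⟩ := hp
    exact ⟨sub_nonneg.mpr h3, sub_le_sub_left h2 1, by simpa using h1⟩
  have hx' : ContDiffOn ℝ j (fun t => x (1 - t)) (Set.Icc 0 1) :=
    hx.comp (f := fun t : ℝ => 1 - t) (by fun_prop) hmaps
  have h1 := contDiffOn_volterra hx (j + 1) le_rfl hl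
  have h2 : ContDiffOn ℝ (j + 1 : ℕ) (fun s => volterra _ _ (1 - s)) (Set.Icc 0 1) :=
    (contDiffOn_volterra hx' (j + 1) le_rfl hu).comp (f := fun t : ℝ => 1 - t)
      (by fun_prop) hmaps
  exact (h1.add h2).congr fun s hs => κ.integralFun_eq_volterra hx.continuousOn hs

/-- Eigenvectors for nonzero eigenvalues have a representative of class `C^α`. -/
theorem exists_contDiffOn_of_eigenvector (hα : 1 ≤ α) {lam : ℂ} (hlam : lam ≠ 0) {v : L2}
    (hv : κ.op v = lam • v) :
    ∃ f : ℝ → ℂ, ContDiffOn ℝ α f (Set.Icc 0 1) ∧ (v : ℝ → ℂ) =ᵐ[mu] f := by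
  set f : ℝ → ℂ := fun s => lam⁻¹ * κ.integralFun v s with hf
  have hvf : (v : ℝ → ℂ) =ᵐ[mu] f := by
    have h := κ.coeFn_op v
    rw [hv] at h
    filter_upwards [h, Lp.coeFn_smul lam v] with s h1 h2
    rw [hf]
    simp only
    rw [← h1, h2, Pi.smul_apply, smul_eq_mul, inv_mul_cancel_left₀ hlam]
  have hint : κ.integralFun v = κ.integralFun f := by
    funext s
    refine integral_congr_ae ?_
    filter_upwards [hvf] with t ht
    rw [ht]
  -- Bootstrap: `f = λ⁻¹ K f`, and each application of `K` gains one derivative until the smoothness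
  -- of the kernel is exhausted.
  have hind : ∀ j : ℕ, j ≤ α → ContDiffOn ℝ j f (Set.Icc 0 1) := by
    intro j
    induction j with
    | zero =>
      intro _
      rw [Nat.cast_zero, contDiffOn_zero]
      exact continuousOn_const.mul (κ.continuousOn_integralFun hα v)
    | succ j ih =>
      intro hj
      have := κ.contDiffOn_integralFun hj (ih (by omega))
      rw [← hint] at this
      exact contDiffOn_const.mul this
  exact ⟨f, hind α le_rfl, hvf⟩

/-! ### Projection errors and the gain from integrating against the kernel -/

section Estimates

variable {r n : ℕ}

theorem cell_length (n j : ℕ) : ((j : ℝ) + 1) / n - (j : ℝ) / n = 1 / n := by ring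

theorem left_mem_Icc_of_fin {n : ℕ} (j : Fin n) : (j : ℝ) / n ∈ Set.Icc (0 : ℝ) 1 := by
  have hn' : (0 : ℝ) < n := by exact_mod_cast j.pos
  refine ⟨by positivity, ?_⟩
  rw [div_le_one hn']
  exact_mod_cast j.2.le

theorem right_mem_Icc_of_fin {n : ℕ} (j : Fin n) : ((j : ℝ) + 1) / n ∈ Set.Icc (0 : ℝ) 1 := by
  have hn' : (0 : ℝ) < n := by exact_mod_cast j.pos
  refine ⟨by positivity, ?_⟩
  rw [div_le_one hn']
  exact_mod_cast j.2

theorem norm_sub_proj_le_of_lipschitz (hn : 0 < n) {x : L2} {f : ℝ → ℂ} (hf : x =ᵐ[mu] f) {L : ℝ}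
    (hL0 : 0 ≤ L) (hL : ∀ s ∈ Set.Icc (0 : ℝ) 1, ∀ t ∈ Set.Icc (0 : ℝ) 1,
      ‖f s - f t‖ ≤ L * |s - t|) : ‖x - proj r n x‖ ≤ L * (1 / n) := by
  obtain ⟨y, hy, hxy⟩ := exists_approxSpace_near (r := r) hn hf (B := fun _ => L * (1 / n))
    fun j => ⟨C (f ((j : ℝ) / n)), by simp, fun t ht => by
      rw [eval_C]
      refine (hL t (cell_subset j ht) _ (left_mem_Icc_of_fin j)).trans ?_
      rw [abs_of_nonneg (sub_nonneg.mpr ht.1.le), ← cell_length n j]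
      gcongr
      exact ht.2⟩
  exact (norm_sub_proj_le_norm_sub x hy).trans (EssBdd.norm_le (by positivity) hxy)

theorem exists_norm_op_sub_proj_le (hα : 1 ≤ α) (r : ℕ) : ∃ C : ℝ, 0 ≤ C ∧ ∀ n : ℕ, 0 < n → ∀ x : L2,
    ‖κ.op x - proj r n (κ.op x)‖ ≤ C * (1 / n) * ‖x‖ := by
  obtain ⟨L, hL0, hL⟩ := κ.exists_norm_integralFun_sub_le hα
  refine ⟨L, hL0, fun n hn x => ?_⟩
  rw [mul_right_comm]
  exact norm_sub_proj_le_of_lipschitz hn (κ.coeFn_op x) (by positivity) (hL x)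

/-- The source of superconvergence: `g` is free and may be adapted to the kink of the section at
`s`. -/
theorem integralFun_sub_proj {s : ℝ} (hs : s ∈ Set.Icc (0 : ℝ) 1) (x : L2) {g : L2}
    (hg : g ∈ approxSpace r n) : κ.integralFun (x - proj r n x : L2) s =
      inner ℂ (κ.kerSection hs - g) (x - proj r n x) := by
  rw [κ.integralFun_eq_inner hs, inner_sub_left, inner_sub_proj x hg, sub_zero]

/-- Cauchy–Schwarz: the Lipschitz section contributes one power of the mesh size, while the full
`L²` error of `x` is retained. -/
theorem exists_essBdd_op_sub_proj (hα : 1 ≤ α) (r : ℕ) : ∃ C : ℝ, 0 ≤ C ∧ ∀ n : ℕ, 0 < n → ∀ x : L2,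
    EssBdd (κ.op (x - proj r n x)) (C * (1 / n) * ‖x - proj r n x‖) := by
  obtain ⟨L, hL0, hL⟩ := κ.exists_lipschitz hα
  refine ⟨L, hL0, fun n hn x => ?_⟩
  filter_upwards [κ.coeFn_op (x - proj r n x), ae_restrict_mem measurableSet_Icc] with s h1 hs
  rw [h1, κ.integralFun_sub_proj hs x (proj_mem (κ.kerSection hs))]
  refine (norm_inner_le_norm _ _).trans ?_
  gcongr
  refine norm_sub_proj_le_of_lipschitz hn (κ.coeFn_kerSection hs) hL0 fun t ht t' ht' => ?_
  rw [← Complex.ofReal_sub, Complex.norm_real]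
  exact (hL s hs t ht t' ht').1

/-- The condition on `s` says that the kink is not interior to `[a,b]`, so one smooth branch covers
the interval. -/
theorem exists_section_linear_approx (hα : 2 ≤ α) : ∃ A : ℝ, 0 ≤ A ∧ ∀ s ∈ Set.Icc (0 : ℝ) 1,
    ∀ a ∈ Set.Icc (0 : ℝ) 1, ∀ b ∈ Set.Icc (0 : ℝ) 1, a ≤ b → (b ≤ s ∨ s ≤ a) →
      ∃ q : ℂ[X], q.natDegree ≤ 1 ∧
        ∀ t ∈ Set.Icc a b, ‖(κ.ker (s, t) : ℂ) - q.eval (t : ℂ)‖ ≤ A * (b - a) ^ 2 := by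
  have hle : (2 : WithTop ℕ∞) ≤ α := by exact_mod_cast hα
  obtain ⟨A₁, hA₁, h₁⟩ := exists_linear_approx convex_lowerTriangle isCompact_lowerTriangle
    uniqueDiffOn_lowerTriangle (κ.contDiffOn_lower.of_le hle)
  obtain ⟨A₂, hA₂, h₂⟩ := exists_linear_approx convex_upperTriangle isCompact_upperTriangle
    uniqueDiffOn_upperTriangle (κ.contDiffOn_upper.of_le hle)
  refine ⟨max A₁ A₂, hA₁.trans (le_max_left _ _), fun s hs a ha b hb hab h => ?_⟩
  rcases h with h | h
  · have hT : ∀ t ∈ Set.Icc a b, (s, t) ∈ lowerTriangle :=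
      fun t ht => ⟨ha.1.trans ht.1, ht.2.trans h, hs.2⟩
    obtain ⟨q, hq, hqe⟩ := h₁ s a b hab hT
    refine ⟨q, hq, fun t ht => ?_⟩
    rw [κ.ker_of_mem_lower (hT t ht)]
    refine (hqe t ht).trans ?_
    gcongr
    exact le_max_left _ _
  · have hT : ∀ t ∈ Set.Icc a b, (s, t) ∈ upperTriangle :=
      fun t ht => ⟨hs.1, h.trans ht.1, ht.2.trans hb.2⟩
    obtain ⟨q, hq, hqe⟩ := h₂ s a b hab hT
    refine ⟨q, hq, fun t ht => ?_⟩
    rw [κ.ker_of_mem_upper (hT t ht)]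
    refine (hqe t ht).trans ?_
    gcongr
    exact le_max_right _ _

/-- With piecewise linear functions the sections of the kernel are approximated to second order
in the mean. -/
theorem exists_integral_section_sub_le (hα : 2 ≤ α) (hr : 1 ≤ r) : ∃ C : ℝ, 0 ≤ C ∧
    ∀ n : ℕ, 0 < n → ∀ (s : ℝ) (hs : s ∈ Set.Icc (0 : ℝ) 1), ∃ g ∈ approxSpace r n,
      ∫ t, ‖(κ.kerSection hs - g) t‖ ∂mu ≤ C * (1 / (n : ℝ)) ^ 2 := by
  obtain ⟨A, hA0, hA⟩ := κ.exists_section_linear_approx hα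
  obtain ⟨L, hL0, hL⟩ := κ.exists_lipschitz (by omega)
  refine ⟨A + 2 * L, by positivity, fun n hn s hs => ?_⟩
  have hn' : (0 : ℝ) < n := by exact_mod_cast hn
  set h : ℝ := 1 / n with hh
  have hh0 : 0 ≤ h := by positivity
  -- The pointwise error is `O(h²)` except on the cell containing `s` in its interior, where it is
  -- `O(h)`. That cell lies in a window of length `2h`, so its contribution to the integral is again
  -- `O(h²)`. Linear pieces are admissible since `r ≥ 1`.
  set B : ℝ → ℝ := fun t => A * h ^ 2 + (Set.Icc (s - h) (s + h)).indicator (fun _ => L * h) t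
  obtain ⟨g, hg, hgB⟩ := exists_approxSpace_near (r := r) hn (κ.coeFn_kerSection hs) (B := B)
    fun j => by
      have hab : (j : ℝ) / n ≤ ((j : ℝ) + 1) / n := by gcongr; linarith
      have hlen := cell_length n j
      by_cases hsj : ((j : ℝ) + 1) / n ≤ s ∨ s ≤ (j : ℝ) / n
      · obtain ⟨q, hq, hqe⟩ := hA s hs _ (left_mem_Icc_of_fin j) _ (right_mem_Icc_of_fin j) hab hsj
        refine ⟨q, hq.trans (by omega), fun t ht => (hqe t (Set.Ioc_subset_Icc_self ht)).trans ?_⟩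
        rw [hlen]
        refine le_add_of_nonneg_right (Set.indicator_nonneg (fun _ _ => by positivity) _)
      · push Not at hsj
        refine ⟨C (κ.ker (s, (j : ℝ) / n) : ℂ), by simp, fun t ht => ?_⟩
        have hmem : t ∈ Set.Icc (s - h) (s + h) := by
          constructor <;> linarith [ht.1, ht.2]
        simp only [B]
        rw [Set.indicator_of_mem hmem, eval_C, ← Complex.ofReal_sub, Complex.norm_real]
        refine ((hL s hs t (cell_subset j ht) _ (left_mem_Icc_of_fin j)).1).trans ?_
        rw [abs_of_nonneg (sub_nonneg.mpr ht.1.le)]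
        have : L * (t - (j : ℝ) / n) ≤ L * h := by
          gcongr
          linarith [ht.2]
        linarith [mul_nonneg hA0 (sq_nonneg h)]
  refine ⟨g, hg, ?_⟩
  have hind : Integrable ((Set.Icc (s - h) (s + h)).indicator fun _ : ℝ => L * h) mu :=
    (integrable_const _).indicator measurableSet_Icc
  have hBi : Integrable B mu := (integrable_const _).add hind
  refine (integral_mono_ae (((Lp.memLp (κ.kerSection hs - g)).integrable (by norm_num)).norm)
    hBi hgB).trans ?_
  have h1 : ∫ t, B t ∂mu = A * h ^ 2 +
      ∫ t, (Set.Icc (s - h) (s + h)).indicator (fun _ => L * h) t ∂mu := by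
    rw [integral_add (integrable_const _) hind]
    simp
  have h2 : mu.real (Set.Icc (s - h) (s + h)) ≤ 2 * h := by
    refine ENNReal.toReal_le_of_le_ofReal (by positivity) ?_
    refine (Measure.restrict_apply_le _ _).trans ?_
    rw [Real.volume_Icc]
    exact ENNReal.ofReal_le_ofReal (by linarith)
  rw [h1, integral_indicator measurableSet_Icc, setIntegral_const, smul_eq_mul]
  have h3 : mu.real (Set.Icc (s - h) (s + h)) * (L * h) ≤ 2 * h * (L * h) := by gcongr
  nlinarith

/-- An `L¹`–`L^∞` pairing instead of Cauchy–Schwarz: the kink spoils second-order approximation of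
the section in `L²` by this choice of `g`, but not in `L¹`. -/
theorem exists_essBdd_op_of_linear (hα : 2 ≤ α) (hr : 1 ≤ r) : ∃ C : ℝ, 0 ≤ C ∧
    ∀ n : ℕ, 0 < n → ∀ (x : L2) (B : ℝ), EssBdd (x - proj r n x) B →
      EssBdd (κ.op (x - proj r n x)) (C * (1 / (n : ℝ)) ^ 2 * B) := by
  obtain ⟨C, hC0, hC⟩ := κ.exists_integral_section_sub_le hα hr
  refine ⟨C, hC0, fun n hn x B hB => ?_⟩
  have hB0 : 0 ≤ B := by
    obtain ⟨t, ht⟩ := hB.exists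
    exact (norm_nonneg _).trans ht
  filter_upwards [κ.coeFn_op (x - proj r n x), ae_restrict_mem measurableSet_Icc] with s h1 hs
  obtain ⟨g, hg, hgC⟩ := hC n hn s hs
  rw [h1, κ.integralFun_sub_proj hs x hg]
  refine (norm_inner_le_integral _ _).trans ?_
  have h2 : ∫ t, ‖(κ.kerSection hs - g) t‖ * ‖(x - proj r n x) t‖ ∂mu ≤
      ∫ t, ‖(κ.kerSection hs - g) t‖ * B ∂mu := by
    refine integral_mono_ae
      ((Lp.memLp (κ.kerSection hs - g)).norm.integrable_mul (Lp.memLp (x - proj r n x)).norm)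
      ((((Lp.memLp (κ.kerSection hs - g)).integrable (by norm_num)).norm).mul_const B) ?_
    filter_upwards [hB] with t ht
    gcongr
  refine h2.trans ?_
  rw [integral_mul_const]
  gcongr

/-- Smooth elements are approximated with the full order in the supremum norm. -/
theorem exists_essBdd_sub_proj_of_contDiffOn (r : ℕ) {v : L2} {f : ℝ → ℂ}
    (hf : ContDiffOn ℝ (2 * r + 1 : ℕ) f (Set.Icc 0 1)) (hv : (v : ℝ → ℂ) =ᵐ[mu] f) :
    ∃ C : ℝ, 0 ≤ C ∧ ∀ n : ℕ, 0 < n → EssBdd (v - proj r n v) (C * (1 / (n : ℝ)) ^ (2 * r + 1)) := by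
  obtain ⟨C, hC0, hC⟩ := exists_polynomial_approx hf
  obtain ⟨c, hc0, hc⟩ := exists_essBdd_sub_proj r
  refine ⟨c * C, by positivity, fun n hn => ?_⟩
  obtain ⟨y, hy, hvy⟩ := exists_approxSpace_near (r := r) hn hv
    (B := fun _ => C * (1 / (n : ℝ)) ^ (2 * r + 1)) fun j => by
      obtain ⟨q, hq, hqe⟩ := hC _ _ (left_mem_Icc_of_fin j) (right_mem_Icc_of_fin j)
      refine ⟨q, hq, fun t ht => ?_⟩
      rw [← cell_length n j]
      exact hqe t (Set.Ioc_subset_Icc_self ht)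
  rw [mul_assoc]
  exact hc n hn v y _ (by positivity) hy hvy

end Estimates

end GreenKernel

end GreenGalerkin

/-! ### Residual equations and error bounds for a Galerkin pair -/

namespace GreenGalerkin

theorem superOrder_le (r : ℕ) : superOrder r ≤ 2 * r + 3 := by
  unfold superOrder; split_ifs <;> omega

/-- A vector `y` of the complementary invariant subspace is controlled by the residual of the
perturbed eigenvalue equation. -/
theorem norm_le_of_reduced_resolvent {X : Type*} [NormedAddCommGroup X] [NormedSpace ℂ X]
    {K E S : X →L[ℂ] X} {lam μ : ℂ} {y g : X}
    (hS : ∀ x, S (lam • x - K x) = x - E x) (hy : E y = 0) (hg : lam • y - K y = μ • y - g)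
    (hμ : ‖S‖ * ‖μ‖ ≤ 1 / 2) : ‖y‖ ≤ 2 * (‖S‖ * ‖g‖) := by
  have h1 := hS y
  rw [hy, sub_zero, hg] at h1
  have h2 : ‖y‖ ≤ ‖S‖ * (‖μ‖ * ‖y‖ + ‖g‖) := by
    calc ‖y‖ = ‖S (μ • y - g)‖ := by rw [h1]
      _ ≤ ‖S‖ * ‖μ • y - g‖ := S.le_opNorm _
      _ ≤ ‖S‖ * (‖μ‖ * ‖y‖ + ‖g‖) := by
        gcongr
        exact (norm_sub_le _ _).trans_eq (by rw [norm_smul])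
  have h3 := mul_le_mul_of_nonneg_right hμ (norm_nonneg y)
  nlinarith

section RangeEstimates

variable {α : ℕ} (κ : GreenKernel α)

/-- The range of `E` is spanned by one smooth eigenvector, so the bound for that vector scales to
all of the range. -/
theorem exists_essBdd_range (r : ℕ) (hα : 2 * r + 1 ≤ α) {lam : ℂ} (hlam : lam ≠ 0)
    {E : L2 →L[ℂ] L2} (hrank : Module.finrank ℂ E.range = 1)
    (hKE : ∀ x, κ.op (E x) = lam • E x) :
    ∃ C : ℝ, 0 ≤ C ∧ ∀ n : ℕ, 0 < n → ∀ x : L2,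
      EssBdd (E x - proj r n (E x)) (C * (1 / (n : ℝ)) ^ (2 * r + 1) * ‖x‖) := by
  obtain ⟨⟨v, hvE⟩, hv0, hspan⟩ := finrank_eq_one_iff'.mp hrank
  obtain ⟨w, hw⟩ := hvE
  have hw' : E w = v := hw
  subst hw'
  have hv0' : ‖E w‖ ≠ 0 := norm_ne_zero_iff.mpr fun h => hv0 (Subtype.ext h)
  obtain ⟨f, hf, hvf⟩ := κ.exists_contDiffOn_of_eigenvector (by omega) hlam (hKE w)
  obtain ⟨C, hC0, hC⟩ := GreenKernel.exists_essBdd_sub_proj_of_contDiffOn r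
    (hf.of_le (by exact_mod_cast hα)) hvf
  refine ⟨‖E‖ / ‖E w‖ * C, by positivity, fun n hn x => ?_⟩
  obtain ⟨a, ha⟩ := hspan ⟨E x, x, rfl⟩
  have ha' : a • E w = E x := congrArg Subtype.val ha
  have hna : ‖a‖ ≤ ‖E‖ * ‖x‖ / ‖E w‖ := by
    rw [le_div_iff₀ (lt_of_le_of_ne (norm_nonneg _) (Ne.symm hv0')), ← norm_smul, ha']
    exact E.le_opNorm x
  have h1 := (hC n hn).smul a
  rw [smul_sub, ← map_smul (proj r n), ha'] at h1
  refine h1.mono ?_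
  calc ‖a‖ * (C * (1 / (n : ℝ)) ^ (2 * r + 1))
      ≤ ‖E‖ * ‖x‖ / ‖E w‖ * (C * (1 / (n : ℝ)) ^ (2 * r + 1)) := by gcongr
    _ = ‖E‖ / ‖E w‖ * C * (1 / (n : ℝ)) ^ (2 * r + 1) * ‖x‖ := by ring

/-- The kernel adds one power of the mesh size for `r = 0` and two for `r ≥ 1`, which is where
`superOrder` comes from. -/
theorem exists_essBdd_op_range (r : ℕ) (hα : 2 * r + 1 ≤ α) {lam : ℂ} (hlam : lam ≠ 0)
    {E : L2 →L[ℂ] L2} (hrank : Module.finrank ℂ E.range = 1)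
    (hKE : ∀ x, κ.op (E x) = lam • E x) :
    ∃ C : ℝ, 0 ≤ C ∧ ∀ n : ℕ, 0 < n → ∀ x : L2,
      EssBdd (κ.op (E x - proj r n (E x))) (C * (1 / (n : ℝ)) ^ superOrder r * ‖x‖) := by
  obtain ⟨A, hA0, hA⟩ := exists_essBdd_range κ r hα hlam hrank hKE
  rcases Nat.eq_zero_or_pos r with rfl | hr
  · obtain ⟨C, hC0, hC⟩ := κ.exists_essBdd_op_sub_proj (by omega) 0
    refine ⟨C * A, by positivity, fun n hn x => (hC n hn (E x)).mono ?_⟩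
    have h1 := (hA n hn x).norm_le (by positivity)
    calc C * (1 / (n : ℝ)) * ‖E x - proj 0 n (E x)‖
        ≤ C * (1 / (n : ℝ)) * (A * (1 / (n : ℝ)) ^ (2 * 0 + 1) * ‖x‖) := by gcongr
      _ = C * A * (1 / (n : ℝ)) ^ superOrder 0 * ‖x‖ := by simp only [superOrder, if_true]; ring
  · obtain ⟨C, hC0, hC⟩ := κ.exists_essBdd_op_of_linear (r := r) (by omega) hr
    refine ⟨C * A, by positivity, fun n hn x => (hC n hn (E x) _ (hA n hn x)).mono (le_of_eq ?_)⟩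
    rw [superOrder, if_neg (by omega)]
    ring

end RangeEstimates

set_option maxHeartbeats 2000000 in
/-- The quantitative perturbation argument: error bounds for an approximate eigenpair. -/
theorem exists_galerkin_estimates {α : ℕ} (κ : GreenKernel α) (r : ℕ) (hα : 2 * r + 1 ≤ α) {lam : ℂ}
    (hlam : lam ≠ 0) {E S : L2 →L[ℂ] L2} (hrank : Module.finrank ℂ E.range = 1)
    (hE : ∀ x, E (E x) = E x) (hKE : ∀ x, κ.op (E x) = lam • E x)
    (hEK : ∀ x, E (κ.op x) = lam • E x) (hS : ∀ x, S (lam • x - κ.op x) = x - E x) :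
    ∃ C δ : ℝ, 0 ≤ C ∧ 0 < δ ∧ ∀ᶠ n : ℕ in atTop, ∀ (μ : ℂ) (φ : L2), ‖lam - μ‖ ≤ δ →
      proj r n (κ.op φ) = μ • φ →
        μ ≠ 0 ∧ ‖lam - μ‖ * ‖φ‖ ≤ C * (1 / (n : ℝ)) ^ superOrder r * ‖φ‖ ∧
        EssBdd (φ - E φ) (C * (1 / (n : ℝ)) ^ (2 * r + 1) * ‖φ‖) ∧
        EssBdd (μ⁻¹ • κ.op φ - E (μ⁻¹ • κ.op φ)) (C * (1 / (n : ℝ)) ^ superOrder r * ‖φ‖) := by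
  obtain ⟨M, hM0, hM⟩ := κ.exists_essBdd_op
  obtain ⟨cP, hcP0, hcP⟩ := exists_essBdd_proj r
  obtain ⟨c₁, hc₁0, hc₁⟩ := κ.exists_norm_op_sub_proj_le (by omega) r
  obtain ⟨c₂, hc₂0, hc₂⟩ := κ.exists_essBdd_op_sub_proj (by omega) r
  obtain ⟨cA, hcA0, hcA⟩ := exists_essBdd_range κ r hα hlam hrank hKE
  obtain ⟨cB, hcB0, hcB⟩ := exists_essBdd_op_range κ r hα hlam hrank hKE
  have hl0 : 0 < ‖lam‖ := norm_pos_iff.mpr hlam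
  -- `E` is bounded from `L²` to `L^∞`
  obtain ⟨m, hm0, hm⟩ : ∃ m : ℝ, 0 ≤ m ∧ ∀ x, EssBdd (E x) (m * ‖x‖) := by
    refine ⟨‖lam⁻¹‖ * (M * ‖E‖), by positivity, fun x => ?_⟩
    have h1 := (hM (E x)).smul lam⁻¹
    rw [hKE, inv_smul_smul₀ hlam] at h1
    refine h1.mono ?_
    rw [mul_assoc, mul_assoc]
    gcongr
    exact E.le_opNorm x
  set e : ℝ := 1 + ‖E‖ with he
  have he0 : 0 < e := by positivity
  set σ : ℝ := ‖S‖ with hσ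
  have hσ0 : 0 ≤ σ := norm_nonneg _
  set cb : ℝ := 4 * σ * e * ‖lam‖ * cA with hcb
  have hcb0 : 0 ≤ cb := by positivity
  set cw : ℝ := ‖lam‖ * cB + c₂ * c₁ * cb with hcw
  have hcw0 : 0 ≤ cw := by positivity
  set cD : ℝ := ‖lam‖ * cA + (1 + cP) * (M * cb) with hcD
  have hcD0 : 0 ≤ cD := by positivity
  set C₁ : ℝ := 2 * ‖E‖ * cw / ‖lam‖ with hC₁
  set C₂ : ℝ := 2 / ‖lam‖ * (M * cb + (cD + m * cD)) with hC₂
  set C₃ : ℝ := 2 / ‖lam‖ * (2 / ‖lam‖ * (M * (2 * (σ * (e * cw))) + (cw + m * cw))) with hC₃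
  have hC₁0 : 0 ≤ C₁ := by positivity
  have hC₂0 : 0 ≤ C₂ := by positivity
  have hC₃0 : 0 ≤ C₃ := by positivity
  -- The first entry of the minimum keeps `μ` away from zero, the second gives `‖S‖ ‖λ - μ‖ ≤ 1/2`;
  -- `σ + 1` avoids dividing by a vanishing `σ`.
  refine ⟨C₁ + C₂ + C₃, min (‖lam‖ / 2) (1 / (2 * (σ + 1))), by positivity, by positivity, ?_⟩
  have hlim : Tendsto (fun n : ℕ => 1 / (n : ℝ)) atTop (𝓝 0) := tendsto_one_div_atTop_nhds_zero_nat
  -- Allows the term `2σ e c₁ h ‖u‖` to be absorbed into half of `‖u‖`.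
  have ev1 : ∀ᶠ n : ℕ in atTop, 4 * σ * e * c₁ * (1 / (n : ℝ)) < 1 := by
    have h := hlim.const_mul (4 * σ * e * c₁)
    rw [mul_zero] at h
    exact h.eventually_lt_const one_pos
  -- Makes `‖u‖ ≤ ‖φ‖ / 2`, so that `‖E φ‖` is at least `‖φ‖ / 2`.
  have ev2 : ∀ᶠ n : ℕ in atTop, 2 * cb * (1 / (n : ℝ)) < 1 := by
    have h := hlim.const_mul (2 * cb)
    rw [mul_zero] at h
    exact h.eventually_lt_const one_pos
  filter_upwards [ev1, ev2, eventually_gt_atTop 0] with n hn1 hn2 hn μ φ hμ hφ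
  set h : ℝ := 1 / (n : ℝ) with hh
  have hh0 : 0 ≤ h := by positivity
  have hh1 : h ≤ 1 := by
    rw [hh, div_le_one (by exact_mod_cast hn)]
    exact_mod_cast hn
  have hμ2 : ‖lam‖ / 2 ≤ ‖μ‖ := by
    have h1 := norm_sub_norm_le lam μ
    have h2 := hμ.trans (min_le_left _ _)
    linarith
  have hμpos : 0 < ‖μ‖ := by linarith
  have hμ0 : μ ≠ 0 := norm_pos_iff.mp hμpos
  have hμinv : ‖μ⁻¹‖ ≤ 2 / ‖lam‖ := by
    rw [norm_inv, inv_le_comm₀ hμpos (by positivity), inv_div]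
    exact hμ2
  have hSμ : ‖S‖ * ‖lam - μ‖ ≤ 1 / 2 := by
    calc ‖S‖ * ‖lam - μ‖ ≤ (σ + 1) * (1 / (2 * (σ + 1))) := by
          gcongr
          · linarith
          · exact hμ.trans (min_le_right _ _)
      _ = 1 / 2 := by field_simp
  have hcompl : ∀ x : L2, ‖x - E x‖ ≤ e * ‖x‖ := fun x => by
    have h1 := norm_sub_le x (E x)
    have h2 := E.le_opNorm x
    rw [he]
    linarith
  have hcomplB : ∀ (x : L2) (B : ℝ), 0 ≤ B → EssBdd x B → EssBdd (x - E x) (B + m * B) :=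
    fun x B hB hx => hx.sub ((hm x).mono (by
      gcongr
      exact hx.norm_le hB))
  set u : L2 := φ - E φ with hu
  have hEu : E u = 0 := by rw [hu, map_sub, hE, sub_self]
  set d : L2 := κ.op φ - proj r n (κ.op φ) with hd
  have hKφ : κ.op φ = lam • E φ + κ.op u := by rw [hu, map_sub, hKE]; abel
  have hKu : κ.op u = κ.op φ - lam • E φ := by rw [hKφ]; abel
  -- Splitting `Kφ = λ Eφ + Ku` separates a smooth part with full approximation order from a part
  -- that is small because `u` is.
  have hdec : d = lam • (E φ - proj r n (E φ)) + (κ.op u - proj r n (κ.op u)) := by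
    rw [hd, hKφ, map_add, map_smul, smul_sub]; abel
  have hcAφ := hcA n hn φ
  have hd2 : ‖d‖ ≤ ‖lam‖ * (cA * h ^ (2 * r + 1) * ‖φ‖) + c₁ * h * ‖u‖ := by
    rw [hdec]
    refine (norm_add_le _ _).trans (add_le_add ?_ (hc₁ n hn u))
    rw [norm_smul]
    gcongr
    exact hcAφ.norm_le (by positivity)
  have hKφd : κ.op φ = μ • φ + d := by rw [hd, hφ]; abel
  -- Applying `1 - E` to `Kφ = μφ + d` gives `(λ - K)u = (λ - μ)u - (d - Ed)`, to which the reduced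
  -- resolvent applies.
  have hb : ‖u‖ ≤ cb * h ^ (2 * r + 1) * ‖φ‖ := by
    have h1 : ‖u‖ ≤ 2 * (‖S‖ * ‖d - E d‖) := by
      refine norm_le_of_reduced_resolvent hS hEu (μ := lam - μ) ?_ hSμ
      have hEd : E d = (lam - μ) • E φ := by
        have : d = κ.op φ - μ • φ := by rw [hKφd]; abel
        rw [this, map_sub, hEK, map_smul, sub_smul]
      rw [hKu, hKφd, hEd, hu]
      simp only [smul_sub, sub_smul]
      abel
    have h2 := hcompl d
    have h3 : ‖u‖ ≤ 2 * (σ * (e * (‖lam‖ * (cA * h ^ (2 * r + 1) * ‖φ‖) + c₁ * h * ‖u‖))) := by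
      refine h1.trans ?_
      gcongr
      exact h2.trans (by gcongr)
    have h4 := mul_le_mul_of_nonneg_right hn1.le (norm_nonneg u)
    rw [hcb]
    nlinarith
  have hpow : h ^ (2 * r + 1) ≤ h := by
    calc h ^ (2 * r + 1) ≤ h ^ 1 := pow_le_pow_of_le_one hh0 hh1 (by omega)
      _ = h := pow_one h
  have hpow3 : h ^ (2 * r + 3) ≤ h ^ superOrder r :=
    pow_le_pow_of_le_one hh0 hh1 (superOrder_le r)
  set W : ℝ := cw * h ^ superOrder r * ‖φ‖ with hW
  have hW0 : 0 ≤ W := by positivity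
  set w : L2 := κ.op d with hw
  -- In the second part of `d`, one factor `h` comes from the kernel, one from `(I - P)K`, and
  -- `h^(2r+1)` from `u`; the total `2r + 3` is at least `superOrder r`.
  have hwB : EssBdd w W := by
    rw [hw, hdec, map_add, map_smul]
    refine ((hcB n hn φ).smul lam |>.add (hc₂ n hn (κ.op u))).mono ?_
    have h1 : c₂ * h * ‖κ.op u - proj r n (κ.op u)‖ ≤
        c₂ * h * (c₁ * h * (cb * h ^ (2 * r + 1) * ‖φ‖)) := by
      gcongr
      exact (hc₁ n hn u).trans (by gcongr)
    have h2 : c₂ * h * (c₁ * h * (cb * h ^ (2 * r + 1) * ‖φ‖)) =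
        c₂ * c₁ * cb * h ^ (2 * r + 3) * ‖φ‖ := by ring
    have h3 : c₂ * c₁ * cb * h ^ (2 * r + 3) * ‖φ‖ ≤ c₂ * c₁ * cb * h ^ superOrder r * ‖φ‖ := by
      gcongr
    rw [hW, hcw]
    calc _ ≤ ‖lam‖ * (cB * h ^ superOrder r * ‖φ‖) + c₂ * c₁ * cb * h ^ superOrder r * ‖φ‖ := by
          linarith
      _ = _ := by ring
  have hwn : ‖w‖ ≤ W := hwB.norm_le hW0
  have hdμ : d = κ.op φ - μ • φ := by rw [hKφd]; abel
  have hwe : w = κ.op (κ.op φ) - μ • κ.op φ := by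
    rw [hw, hdμ, map_sub, map_smul]
  have hP : 0 ≤ h ^ superOrder r * ‖φ‖ := by positivity
  have hP' : 0 ≤ h ^ (2 * r + 1) * ‖φ‖ := by positivity
  refine ⟨hμ0, ?_, ?_, ?_⟩
  · have h1 : E w = (lam * (lam - μ)) • E φ := by
      rw [hwe, map_sub, map_smul, hEK, hEK, mul_sub, sub_smul, smul_smul, smul_smul, mul_comm μ]
    have h2 : ‖lam‖ * ‖lam - μ‖ * ‖E φ‖ ≤ ‖E‖ * W := by
      rw [← norm_mul, ← norm_smul, ← h1]
      exact (E.le_opNorm w).trans (by gcongr)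
    have h3 : ‖φ‖ / 2 ≤ ‖E φ‖ := by
      have h4 : ‖φ‖ ≤ ‖u‖ + ‖E φ‖ := by
        have := norm_add_le u (E φ)
        rwa [hu, sub_add_cancel] at this
      have h5 : cb * h ^ (2 * r + 1) * ‖φ‖ ≤ cb * h * ‖φ‖ := by gcongr
      have h6 := mul_le_mul_of_nonneg_right hn2.le (norm_nonneg φ)
      linarith
    have h7 : ‖lam‖ * ‖lam - μ‖ * (‖φ‖ / 2) ≤ ‖E‖ * W := le_trans (by gcongr) h2
    have h8 : ‖lam - μ‖ * ‖φ‖ ≤ C₁ * h ^ superOrder r * ‖φ‖ := by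
      rw [hC₁, div_mul_eq_mul_div, div_mul_eq_mul_div, le_div_iff₀ hl0]
      rw [hW] at h7
      linarith
    refine h8.trans ?_
    gcongr
    linarith
  · have h1 : EssBdd d (cD * h ^ (2 * r + 1) * ‖φ‖) := by
      have hKuB : EssBdd (κ.op u) (M * (cb * h ^ (2 * r + 1) * ‖φ‖)) :=
        (hM u).mono (by gcongr)
      rw [hdec]
      refine ((hcAφ.smul lam).add (hKuB.sub (hcP n hn _ _ (by positivity) hKuB))).mono
        (le_of_eq ?_)
      rw [hcD]; ring
    -- Expresses `u` through `Ku`, upgrading its `L²` bound to a sup-norm bound.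
    have h2 : μ • u = κ.op u - (d - E d) := by
      rw [hKu, hdμ, map_sub, hEK, map_smul, hu, smul_sub]; abel
    have h3 := ((hM u).sub (hcomplB d _ (by positivity) h1)).smul μ⁻¹
    rw [← h2, inv_smul_smul₀ hμ0] at h3
    refine h3.mono ?_
    calc ‖μ⁻¹‖ * (M * ‖u‖ + (cD * h ^ (2 * r + 1) * ‖φ‖ + m * (cD * h ^ (2 * r + 1) * ‖φ‖)))
        ≤ 2 / ‖lam‖ * (M * (cb * h ^ (2 * r + 1) * ‖φ‖) + (cD * h ^ (2 * r + 1) * ‖φ‖ +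
          m * (cD * h ^ (2 * r + 1) * ‖φ‖))) := by gcongr
      _ = C₂ * h ^ (2 * r + 1) * ‖φ‖ := by rw [hC₂]; ring
      _ ≤ (C₁ + C₂ + C₃) * h ^ (2 * r + 1) * ‖φ‖ := by gcongr; linarith
  · set y : L2 := κ.op u with hy
    have hEy : E y = 0 := by rw [hy, hEK, hEu, smul_zero]
    -- The equation of `u` after one application of `K`: the source is now `w`, which has the higher
    -- order. It yields the `L²` bound through `S` and then the sup-norm bound through `K y`.
    have hμy : μ • y = κ.op y - (w - E w) := by
      have h1 : κ.op y = κ.op (κ.op φ) - lam • lam • E φ := by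
        rw [hKu, map_sub, map_smul, hKE]
      rw [h1, hwe, map_sub, map_smul, hEK, hEK, hKu]
      simp only [smul_sub]
      abel
    have hyn : ‖y‖ ≤ 2 * (σ * (e * W)) := by
      have h1 : ‖y‖ ≤ 2 * (‖S‖ * ‖w - E w‖) := by
        refine norm_le_of_reduced_resolvent hS hEy (μ := lam - μ) ?_ hSμ
        rw [sub_smul, hμy]
        abel
      refine h1.trans ?_
      gcongr
      exact (hcompl w).trans (by gcongr)
    have h3 := ((hM y).sub (hcomplB w W hW0 hwB)).smul μ⁻¹
    rw [← hμy, inv_smul_smul₀ hμ0] at h3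
    have h4 : μ⁻¹ • κ.op φ - E (μ⁻¹ • κ.op φ) = μ⁻¹ • y := by
      rw [map_smul, hEK, hKu, smul_sub]
    rw [h4]
    refine (h3.smul μ⁻¹).mono ?_
    calc ‖μ⁻¹‖ * (‖μ⁻¹‖ * (M * ‖y‖ + (W + m * W)))
        ≤ 2 / ‖lam‖ * (2 / ‖lam‖ * (M * (2 * (σ * (e * W))) + (W + m * W))) := by gcongr
      _ = C₃ * h ^ superOrder r * ‖φ‖ := by rw [hC₃, hW]; ring
      _ ≤ (C₁ + C₂ + C₃) * h ^ superOrder r * ‖φ‖ := by gcongr; linarith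

/-- Convergence holds in operator norm, not merely pointwise, because `K` smooths uniformly on the
unit ball. -/
theorem tendsto_galerkinOp {α : ℕ} (κ : GreenKernel α) (hα : 1 ≤ α) (r : ℕ) :
    Tendsto (galerkinOp κ r) atTop (𝓝 κ.op) := by
  obtain ⟨C, hC0, hC⟩ := κ.exists_norm_op_sub_proj_le hα r
  rw [tendsto_iff_norm_sub_tendsto_zero]
  have hlim : Tendsto (fun n : ℕ => C * (1 / (n : ℝ))) atTop (𝓝 0) := by
    have := (tendsto_one_div_atTop_nhds_zero_nat (𝕜 := ℝ)).const_mul C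
    rwa [mul_zero] at this
  refine squeeze_zero' (Eventually.of_forall fun n => norm_nonneg _) ?_ hlim
  filter_upwards [eventually_gt_atTop 0] with n hn
  rw [norm_sub_rev]
  exact ContinuousLinearMap.opNorm_le_bound _ (by positivity) fun x => hC n hn x

/-- A Galerkin eigenvector can be normalised in the supremum norm. -/
theorem exists_smul_essSupNorm_eq_one {x : L2} (hx : x ≠ 0) {B : ℝ} (hB : EssBdd x B) :
    ∃ c : ℂ, essSupNorm (c • x) = 1 := by
  have htop : essSupNorm x ≠ ⊤ := (hB.essSupNorm_le.trans_lt ENNReal.ofReal_lt_top).ne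
  have h0 : essSupNorm x ≠ 0 := fun h => hx (Lp.ext (by
    have := (eLpNorm_eq_zero_iff (Lp.aestronglyMeasurable x) ENNReal.top_ne_zero).mp h
    exact this.trans (Lp.coeFn_zero ℂ 2 mu).symm))
  refine ⟨((essSupNorm x).toReal⁻¹ : ℝ), ?_⟩
  have hpos : 0 < (essSupNorm x).toReal := ENNReal.toReal_pos h0 htop
  rw [essSupNorm, eLpNorm_congr_ae (Lp.coeFn_smul _ x), eLpNorm_const_smul]
  change ‖(((essSupNorm x).toReal⁻¹ : ℝ) : ℂ)‖ₑ * essSupNorm x = 1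
  rw [← ofReal_norm, Complex.norm_real, Real.norm_of_nonneg (by positivity),
    ENNReal.ofReal_inv_of_pos hpos, ENNReal.ofReal_toReal htop, ENNReal.inv_mul_cancel h0 htop]

end GreenGalerkin

/-! ### Convergence of the spectral projections and the final bounds -/

theorem mainTheorem1 (r α : ℕ) (hα : 2 * r + 1 ≤ α) (κ : GreenKernel α)
    (lam : ℂ) (hlam : lam ≠ 0) (hsimple : IsSimpleEigenvalue κ.op lam)
    (ε : ℝ) (hε : Separates κ.op lam ε) :
    ∃ C : ℝ, ∀ᶠ n : ℕ in atTop,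
      (∀ z ∈ Metric.sphere lam ε, z ∈ resolventSet ℂ (galerkinOp κ r n)) ∧
      Module.finrank ℂ (spectralProj (galerkinOp κ r n) lam ε).range = 1 ∧
      ∃ lamG : ℂ, lamG ≠ 0 ∧
        IsEigenvalue (galerkinOp κ r n) lamG ∧
        spectrum ℂ (galerkinOp κ r n) ∩ Metric.ball lam ε = {lamG} ∧
        ‖lam - lamG‖ ≤ C * (1 / (n : ℝ)) ^ superOrder r ∧
        (∃ φ ∈ (spectralProj (galerkinOp κ r n) lam ε).range, essSupNorm φ = 1) ∧
        ∀ φ ∈ (spectralProj (galerkinOp κ r n) lam ε).range, essSupNorm φ = 1 →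
          galerkinOp κ r n φ = lamG • φ ∧
          essSupNorm (φ - spectralProj κ.op lam ε φ) ≤
            ENNReal.ofReal (C * (1 / (n : ℝ)) ^ (2 * r + 1)) ∧
          essSupNorm (lamG⁻¹ • κ.op φ - spectralProj κ.op lam ε (lamG⁻¹ • κ.op φ)) ≤
            ENNReal.ofReal (C * (1 / (n : ℝ)) ^ superOrder r) := by
  have hα1 : 1 ≤ α := by omega
  have hε0 : 0 < ε := hε.1
  have hs : Metric.sphere lam ε ⊆ resolventSet ℂ κ.op :=
    (sphere_subset_annulus le_rfl).trans (hε.annulus_subset hε0)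
  have hball : lam ∈ Metric.ball lam ε := Metric.mem_ball_self hε0
  obtain ⟨hEidem, hErank, hKE⟩ := hsimple.rieszProj_spec hε
  set E := rieszProj κ.op lam ε with hEdef
  set S := cauchyResolvent κ.op lam ε lam with hSdef
  have hEK : ∀ x, E (κ.op x) = lam • E x := fun x => by
    rw [← hKE]
    exact DFunLike.congr_fun (commute_rieszProj (Commute.refl κ.op) hε0.le hs).eq x
  -- At `w = λ` the Cauchy integral of the resolvent is the reduced resolvent; commutation puts it
  -- on the left of `λ - K`.
  have hS : ∀ x, S (lam • x - κ.op x) = x - E x := fun x => by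
    have hc : Commute S (algebraMap ℂ (L2 →L[ℂ] L2) lam - κ.op) :=
      commute_cauchyResolvent ((Algebra.commute_algebraMap_right _ _).sub_right (Commute.refl _))
        hε0.le hs hball
    have h1 := sub_mul_cauchyResolvent hs hball
    rw [← hSdef, ← hc.eq] at h1
    have h2 := DFunLike.congr_fun h1 x
    simpa only [mul_apply_eq_comp, sub_apply, Algebra.algebraMap_eq_smul_one, smul_apply,
      one_apply_eq_self] using h2
  obtain ⟨C, δ, hC0, hδ0, hest⟩ := exists_galerkin_estimates κ r hα hlam hErank
    (fun x => DFunLike.congr_fun hEidem x) hKE hEK hS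
  set ρ : ℝ := min δ (ε / 2) with hρ
  have hρ0 : 0 < ρ := by positivity
  have hρε : ρ < ε := (min_le_right _ _).trans_lt (half_lt_self hε0)
  have hT := tendsto_galerkinOp κ hα1 r
  -- Freeing this whole annulus from the spectrum of `P K` puts the circle in the resolvent set,
  -- supplies the two radii needed for idempotency, and forces the eigenvalue within `ρ ≤ δ` of `λ`.
  have hcompact : IsCompact (Metric.closedBall lam ε \ Metric.ball lam ρ) :=
    (isCompact_closedBall lam ε).diff Metric.isOpen_ball
  have ev1 := hT.eventually (eventually_subset_resolventSet hcompact (hε.annulus_subset hρ0))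
  have ev2 := (Metric.tendsto_nhds.mp ((tendsto_rieszProj hε0.le hs).comp hT)) 1 one_pos
  obtain ⟨M, hM0, hM⟩ := κ.exists_essBdd_op
  obtain ⟨cP, hcP0, hcP⟩ := exists_essBdd_proj r
  refine ⟨C, ?_⟩
  filter_upwards [ev1, ev2, hest, eventually_gt_atTop 0] with n hann hdist hestn hn
  set T := galerkinOp κ r n with hTdef
  set En := rieszProj T lam ε with hEn
  have hsn : Metric.sphere lam ε ⊆ resolventSet ℂ T := (sphere_subset_annulus hρε.le).trans hann
  have hEnidem : IsIdempotentElem En := isIdempotentElem_rieszProj hρ0 hρε hann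
  have hfin : Module.Finite ℂ E.range := Module.finite_of_finrank_pos (by rw [hErank]; exact one_pos)
  have hnorm : ‖En - E‖ < 1 := by rw [← dist_eq_norm]; exact hdist
  have hEnrank : Module.finrank ℂ En.range = 1 :=
    (finrank_range_eq_of_norm_sub_lt_one hEnidem hEidem hnorm).trans hErank
  have hfix := exists_fixed_of_finrank_range_eq_one hEnidem hEnrank
  obtain ⟨μ, hμball, hTμ⟩ :=
    exists_eigenvalue_of_finrank_range_rieszProj hε0.le hsn hfix hEnrank
  obtain ⟨w, hw0, hw, -⟩ := hfix
  have hμδ : ‖lam - μ‖ ≤ δ := by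
    have h1 : μ ∈ Metric.ball lam ρ := by
      by_contra h
      exact mem_spectrum_of_eigenvector hw0 (hTμ w hw)
        (hann ⟨Metric.ball_subset_closedBall hμball, h⟩)
    rw [norm_sub_rev, ← dist_eq_norm]
    exact (Metric.mem_ball.mp h1).le.trans (min_le_left _ _)
  obtain ⟨hμ0, hlamμ, -, -⟩ := hestn μ w hμδ (hTμ w hw)
  rw [spectralProj_eq_rieszProj T, spectralProj_eq_rieszProj κ.op, ← hEn, ← hEdef]
  refine ⟨hsn, hEnrank, μ, hμ0, ?_, ?_, ?_, ?_, ?_⟩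
  · exact Module.End.hasEigenvalue_of_hasEigenvector
      (Module.End.hasEigenvector_iff.mpr ⟨Module.End.mem_eigenspace_iff.mpr (hTμ w hw), hw0⟩)
  · exact spectrum_inter_ball_eq_singleton hsn hEnidem hμball hTμ ⟨w, hw, hw0⟩
  · exact le_of_mul_le_mul_right hlamμ (norm_pos_iff.mpr hw0)
  -- Since `w = μ⁻¹ P K w`, it is essentially bounded and can be normalised.
  · have hTw : proj r n (κ.op w) = μ • w := hTμ w hw
    have hwB := (hcP n hn _ _ (by positivity) (hM w)).smul μ⁻¹
    rw [hTw, inv_smul_smul₀ hμ0] at hwB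
    obtain ⟨c, hc⟩ := exists_smul_essSupNorm_eq_one hw0 hwB
    exact ⟨c • w, Submodule.smul_mem _ c hw, hc⟩
  · intro φ hφ hφ1
    -- On a probability space the `L²` norm is at most the sup norm, so the factor `‖φ‖` disappears
    -- from the estimates.
    have hφn : ‖φ‖ ≤ 1 := (essBdd_of_essSupNorm_eq_one hφ1).norm_le zero_le_one
    obtain ⟨-, -, h1, h2⟩ := hestn μ φ hμδ (hTμ φ hφ)
    refine ⟨hTμ φ hφ, (h1.mono ?_).essSupNorm_le, (h2.mono ?_).essSupNorm_le⟩
    · exact mul_le_of_le_one_right (by positivity) hφn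
    · exact mul_le_of_le_one_right (by positivity) hφn
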